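/- **Setting.** Let $G$ be an acyclic directed mixed graph (ADMG) on a finite vertex set $\vec V$: it has directed edges without directed cycles, and bidirected edges between distinct vertices. Let $d$ be the maximum in-degree of $G$ (number of directed edges into a vertex). The c-components of $G$ are the maximal sets of vertices connected by bidirected edges; let $k$ be the size of the largest one. Let $\Sigma$ be a finite alphabet. A (semi-Markovian) causal Bayes net $\mathcal P$ over $G$ has observable variables $\vec V$ with values in $\Sigma$, and finitely many independent hidden variables with values in arbitrary probability spaces. Hidden variables have no parents and each affects exactly two observable variables; the bidirected edges of $G$ are exactly the pairs of observable variables that have a common hidden parent. Each observable variable has a conditional distribution given its observable parents (the directed edges of $G$) and its hidden parents. $P$ denotes the joint law of $\vec V$, and for $X\in\vec V$, $x\in\Sigma$, $P_x$ denotes the law of $\vec V$ after replacing the conditional distribution of $X$ by the point mass at $x$. For $\vec F\subseteq \vec V$, $P_x|_{\vec F}$ is the marginal of $P_x$ on $\vec F$. Let $\vec S_1$ be the c-component of $X$ and $\vec Z=\vec S_1\cup\bigcup_{V\in \vec S_1}\mathrm{Pa}(V)$, where $\mathrm{Pa}(V)$ are the observable parents of $V$. $G$ is identifiable with respect to $X$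 if no child of $X$ lies in $\vec S_1$. $\mathcal P$ is $\alpha$-strongly positive with respect to $X$ if $P(\vec Z=\vec z)>\alpha$ for every assignment $\vec z\in\Sigma^{\vec Z}$. Algorithms are programs for a unit-cost random access machine (arithmetic operations on rational numbers, comparison jumps, indirect addressing, and reading the symbol of a given variable in a given sample, each at cost one). An evaluator for a distribution $p$ on $\Sigma^{\vec F}$ consists of the memory left by the algorithm and a program, fixed before the samples are drawn, that, started on this memory with an assignment $\vec w\in\Sigma^{\vec F}$ as input, outputs $p(\vec w)$. **Theorem.** There are universal constants $C>0$ and $c\in\mathbb N$ such that the following holds. Let $G$ be a (known) ADMG on $\vec V$ that is identifiable with respect to $X\in\vec V$, let $\vec F\subseteq\vec V$ with $|\vec F|=f$, let $x\in\Sigma$ be an intervention to $X$, let $\alpha,\epsilon,\delta\in(0,1)$, and put $$N=f+k(d+1),\qquad B=\frac{|\Sigma|^{2N^2}}{\alpha^k\epsilon^2}.$$ Then there are a number $$m\le C\,B\,(1+\log B)^{c}\,(1+\log(1/\delta)),\qquad\text{i.e. } m=\tilde O\!\left(\frac{|\Sigma|^{2(f+k(d+1))^2}}{\alpha^k\epsilon^2}\right)\cdot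 O(1+\log(1/\delta)),$$ and an algorithm that takes $m$ samples and, on every sample sequence, halts within $$T=C\,m\,(f+k(d+1))\,|\Sigma|^{2(f+k(d+1))^2}$$ steps, such that for every causal Bayes net $\mathcal P$ over $G$ that is $\alpha$-strongly positive with respect to $X$, the following holds with probability at least $1-\delta$ over $m$ independent samples from the observational distribution $P$: the algorithm returns an evaluator for a probability distribution $\tilde P_{\vec F}$ on $\Sigma^{\vec F}$ with $$d_{\mathrm{TV}}(P_x|_{\vec F},\tilde P_{\vec F})\le\epsilon .$$ Moreover, the lengths of the algorithm's program and of the evaluation program, and the time of every evaluation, are also at most $T$. None of the bounds depends on $n=|\vec V|$. -/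

import Mathlib

universe u v w

/-! ### Acyclic directed mixed graphs -/

/-- An acyclic directed mixed graph (ADMG) on the vertex set `V`: directed edges without
directed cycles, and (undirected, loopless) bidirected edges. A pair of vertices may carry both. -/
structure ADMG (V : Type*) where
  /-- `directed a b` means that there is a directed edge `a → b`. -/
  directed : V → V → Prop
  acyclic : ∀ v, ¬ Relation.TransGen directed v v
  bidirected : SimpleGraph V

namespace ADMG

variable {V : Type*} [Fintype V] (G : ADMG V)

open Classical in
/-- The (observable) parents of a vertex. -/
noncomputable def parents (v : V) : Finset V :=
  Finset.univ.filter fun p => G.directed p v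

/-- The maximum number of directed edges coming into any vertex. -/
noncomputable def inDegree : ℕ :=
  Finset.univ.sup fun v => (G.parents v).card

open Classical in
/-- The c-component of a vertex: all vertices joined to it by a path of bidirected edges. -/
noncomputable def cComponent (v : V) : Finset V :=
  Finset.univ.filter fun w => G.bidirected.Reachable v w

/-- The size of the largest c-component. -/
noncomputable def maxCComponent : ℕ :=
  Finset.univ.sup fun v => (G.cComponent v).card

/-- `S` together with all parents of its elements. -/
noncomputable def paPlus [DecidableEq V] (S : Finset V) : Finset V :=
  S ∪ S.biUnion G.parents

/-- Identifiability with respect to `X`: no child of `X` lies in the c-component of `X`. -/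
def Identifiable (X : V) : Prop :=
  ∀ c, G.directed X c → c ∉ G.cComponent X

end ADMG

/-! ### Finite distributions, given by their mass functions -/

/-- `p` is a probability mass function on the finite type `Ω`. -/
def IsDistribution {Ω : Type*} [Fintype Ω] (p : Ω → ℝ) : Prop :=
  (∀ w, 0 ≤ p w) ∧ ∑ w, p w = 1

/-- Total variation distance of two mass functions on a finite type. -/
noncomputable def tvDist {Ω : Type*} [Fintype Ω] (p q : Ω → ℝ) : ℝ :=
  (1 / 2) * ∑ w, |p w - q w|

/-- The marginal on the coordinates in `S` of a mass function on `V → A`. -/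
def marginal {V A : Type*} [Fintype V] [DecidableEq V] [Fintype A] [DecidableEq A]
    (S : Finset V) (p : (V → A) → ℝ) (w : S → A) : ℝ :=
  ∑ σ : V → A with (fun v : S => σ v) = w, p σ

open Classical in
/-- The probability of the event `Good` for `m` independent samples drawn from `p`. -/
noncomputable def iidProb {Ω : Type*} [Fintype Ω] (p : Ω → ℝ) (m : ℕ)
    (Good : (Fin m → Ω) → Prop) : ℝ :=
  ∑ s : Fin m → Ω with Good s, ∏ i, p (s i)

/-! ### Causal Bayes nets -/

/-- A (semi-Markovian) causal Bayes net over the ADMG `G` whose observable variables are the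
vertices of `G`, with values in `A`. Every hidden variable is a root of the underlying graph, takes
values in an arbitrary probability space, and affects exactly two observable variables; the
bidirected edges of `G` are the pairs of observable variables with a common hidden parent. The
hidden variables are independent, and every observable variable has a conditional distribution
given its observable and hidden parents. -/
structure CausalBayesNet {V : Type u} (G : ADMG V) (A : Type v) [Fintype A] where
  /-- The index set of the hidden variables. -/
  Hidden : Type w
  [fintypeHidden : Fintype Hidden]
  /-- The two observable variables that a hidden variable affects. -/
  ends : Hidden → Sym2 V
  range_ends : Set.range ends = G.bidirected.edgeSet
  /-- The range of each hidden variable. -/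
  Val : Hidden → Type w
  [measurableSpaceVal : ∀ h, MeasurableSpace (Val h)]
  /-- The law of each hidden variable. -/
  prior : ∀ h, MeasureTheory.Measure (Val h)
  [isProbabilityMeasure_prior : ∀ h, MeasureTheory.IsProbabilityMeasure (prior h)]
  /-- `mech v pa u a` is the conditional probability that the variable `v` equals `a` given the
  values `pa` of its observable parents and the values `u` of its hidden parents. -/
  mech : ∀ v : V, ({p // G.directed p v} → A) → (∀ h : {h // v ∈ ends h}, Val h) → A → ℝ
  measurable_mech : ∀ v pa a, Measurable fun u => mech v pa u a
  mech_nonneg : ∀ v pa u a, 0 ≤ mech v pa u a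
  mech_sum : ∀ v pa u, ∑ a, mech v pa u a = 1

namespace CausalBayesNet

attribute [instance] CausalBayesNet.fintypeHidden CausalBayesNet.measurableSpaceVal
  CausalBayesNet.isProbabilityMeasure_prior

variable {V : Type u} [Fintype V] [DecidableEq V] {G : ADMG V} {A : Type v} [Fintype A]
  [DecidableEq A] (M : CausalBayesNet.{u, v, w} G A)

/-- The joint law of the (independent) hidden variables. -/
noncomputable def hiddenLaw : MeasureTheory.Measure (∀ h, M.Val h) :=
  MeasureTheory.Measure.pi M.prior

/-- The conditional probability of the value `σ v` of the variable `v` under the full assignment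
`σ` to the observable and `u` to the hidden variables. -/
def factor (σ : V → A) (u : ∀ h, M.Val h) (v : V) : ℝ :=
  M.mech v (fun p => σ p.1) (fun h => u h.1) (σ v)

/-- The observational distribution `P`, as a mass function. -/
noncomputable def obs (σ : V → A) : ℝ :=
  ∫ u, ∏ v, M.factor σ u v ∂M.hiddenLaw

/-- The interventional distribution `P_x` for the intervention that sets `X` to `x`, as a mass
function on the assignments to all observable variables: the conditional distribution of `X` is
replaced by the point mass at `x`. -/
noncomputable def interv (X : V) (x : A) (σ : V → A) : ℝ :=
  if σ X = x then ∫ u, ∏ v ∈ Finset.univ.erase X, M.factor σ u v ∂M.hiddenLaw else 0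

/-- `α`-strong positivity with respect to `X`: with `S` the c-component of `X`, every assignment
to `S` and its parents has observational probability larger than `α`. -/
def StronglyPositive (X : V) (α : ℝ) : Prop :=
  ∀ z : G.paPlus (G.cComponent X) → A, α < marginal (G.paPlus (G.cComponent X)) M.obs z

end CausalBayesNet

/-! ### Random access machines with step count -/

/-- The instructions of a unit-cost random access machine. Its memory cells are indexed by `ℕ` and
hold rational numbers; an indirect address is the content of a cell, rounded down. The input device
holds for every index `i` and every variable `v : V` one symbol, given by its number. -/
inductive Instr (V : Type*) where
  /-- `mem[dst] := c` -/
  | const (dst c : ℕ)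
  /-- `mem[dst] := mem[a] + mem[b]` -/
  | add (dst a b : ℕ)
  /-- `mem[dst] := mem[a] - mem[b]` -/
  | sub (dst a b : ℕ)
  /-- `mem[dst] := mem[a] * mem[b]` -/
  | mul (dst a b : ℕ)
  /-- `mem[dst] := mem[a] / mem[b]`, where division by zero gives zero -/
  | div (dst a b : ℕ)
  /-- `mem[dst] := mem[mem[a]]` -/
  | load (dst a : ℕ)
  /-- `mem[mem[a]] := mem[b]` -/
  | store (a b : ℕ)
  /-- go to instruction number `target` if `mem[a] ≤ mem[b]` -/
  | jumpLE (a b target : ℕ)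
  /-- `mem[dst] :=` the input symbol with index `mem[i]` for the variable `v` -/
  | read (dst i : ℕ) (v : V)

/-- A configuration: the number of the next instruction, and the memory. -/
structure Config where
  pc : ℕ
  mem : ℕ → ℚ

namespace RAM

variable {V : Type*}

/-- Execution of one instruction with the input `inp`. -/
def exec (inp : ℕ → V → ℕ) (s : Config) : Instr V → Config
  | .const dst c => ⟨s.pc + 1, Function.update s.mem dst (c : ℚ)⟩
  | .add dst a b => ⟨s.pc + 1, Function.update s.mem dst (s.mem a + s.mem b)⟩
  | .sub dst a b => ⟨s.pc + 1, Function.update s.mem dst (s.mem a - s.mem b)⟩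
  | .mul dst a b => ⟨s.pc + 1, Function.update s.mem dst (s.mem a * s.mem b)⟩
  | .div dst a b => ⟨s.pc + 1, Function.update s.mem dst (s.mem a / s.mem b)⟩
  | .load dst a => ⟨s.pc + 1, Function.update s.mem dst (s.mem ⌊s.mem a⌋₊)⟩
  | .store a b => ⟨s.pc + 1, Function.update s.mem ⌊s.mem a⌋₊ (s.mem b)⟩
  | .jumpLE a b target => ⟨if s.mem a ≤ s.mem b then target else s.pc + 1, s.mem⟩
  | .read dst i v => ⟨s.pc + 1, Function.update s.mem dst (inp ⌊s.mem i⌋₊ v : ℚ)⟩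

/-- One step of the program `prog`; it has halted when there is no next instruction. -/
def step (prog : List (Instr V)) (inp : ℕ → V → ℕ) (s : Config) : Config :=
  match prog[s.pc]? with
  | none => s
  | some instr => exec inp s instr

/-- Started on the memory `mem`, the program `prog` halts after at most `T` steps and leaves the
memory `mem'`. -/
def HaltsWithin (prog : List (Instr V)) (inp : ℕ → V → ℕ) (mem : ℕ → ℚ) (T : ℝ)
    (mem' : ℕ → ℚ) : Prop :=
  ∃ t pc' : ℕ, (t : ℝ) ≤ T ∧ (step prog inp)^[t] ⟨0, mem⟩ = ⟨pc', mem'⟩ ∧ prog.length ≤ pc'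

variable {A : Type*} [Fintype A]

/-- The number of a symbol of the alphabet, in `0, …, |A| - 1`. -/
noncomputable def code (a : A) : ℕ := (Fintype.equivFin A a : ℕ)

/-- The input that consists of `m` samples. -/
noncomputable def sampleInput {m : ℕ} (s : Fin m → V → A) (i : ℕ) (v : V) : ℕ :=
  if h : i < m then code (s ⟨i, h⟩ v) else 0

/-- The input that consists of one assignment to the variables in `F`. -/
noncomputable def queryInput [DecidableEq V] {F : Finset V} (w : F → A) (_ : ℕ) (v : V) : ℕ :=
  if h : v ∈ F then code (w ⟨v, h⟩) else 0

/-- Started on the memory `mem`, which is all the data it gets, the program `eval` is an evaluator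
for `p`: for every assignment `w` to `F` it halts after at most `T` steps with the value `p w` in
cell `0`. -/
def IsEvaluator [DecidableEq V] (eval : List (Instr V)) (mem : ℕ → ℚ) (T : ℝ) {F : Finset V}
    (p : (F → A) → ℝ) : Prop :=
  ∀ w : F → A, ∃ mem' : ℕ → ℚ,
    HaltsWithin eval (queryInput w) mem T mem' ∧ ((mem' 0 : ℚ) : ℝ) = p w

end RAM

/-! Let `S` be the c-component of `X`, `Z` the set `S` with its parents, and let `Q[T]`
(`partialLaw`) be the mean over the hidden variables of the product of the mechanisms of `T`. No
hidden variable affects both `S` and its complement, so `P = Q[S] * Q[Sᶜ]` (`partialLaw_mul`). As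
`X` has no child in `S`, summing `Q[S]` over the value of `X` gives `Q[S \ {X}]`. Hence, where `X =
x`, the law `P_x` is `P` times the density `(∑ a, Q[S](X := a)) / Q[S]` (`interv_eq`). Along a
topological order, `Q[S]` is the product over `v ∈ S` of the conditional probabilities of `v` given
the earlier part of `Z` (`partialLaw_cComponent`). So `P_x` on `F` is an explicit functional
`plugIn` of the joint law on `F` and `Z`, which has at most `|A| ^ N` cells however many vertices
there are.

The algorithm applies `plugIn` to the empirical distribution. By Chernoff and strong positivity,
every cell `(w, z)` is known up to `η / |A| ^ f` times `P(Z = z)`, with `η` of order `ε / N`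
(`one_sub_le_iidProb_forall`). Summing over `w` gives relative error `η` for all cylinders over
subsets of `Z`, so the density is right up to the factor `exp (8 * |S| * η)` and the functional has
a small `L¹` error (`sum_abs_plugIn_sub_le`), which normalization at most doubles
(`isDistribution_div_sum`). The factor `|A| ^ (2 * N ^ 2)` leaves so much room that one power of `α`
and no logarithm of `B` are needed (`card_mul_exp_le`).

For the running time, the functional is written as an arithmetic expression and compiled to a
jump-free program, whose running time is its length (`haltsWithin_of_jumpFree`, `cost_plug_le`). -/

set_option linter.unusedSectionVars false

/-! ### Jump-free programs and the compilation of arithmetic expressions -/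

namespace RAM

variable {V : Type*}

/-- The effect of an instruction on the memory. -/
def effect (inp : ℕ → V → ℕ) (mem : ℕ → ℚ) (i : Instr V) : ℕ → ℚ :=
  (exec inp ⟨0, mem⟩ i).mem

/-- The effect of a jump-free program on the memory. -/
def run (inp : ℕ → V → ℕ) (prog : List (Instr V)) (mem : ℕ → ℚ) : ℕ → ℚ :=
  prog.foldl (effect inp) mem

/-- An instruction is jump-free if it always passes on to the next instruction. -/
def JumpFree : Instr V → Prop
  | .jumpLE _ _ _ => False
  | _ => True

theorem run_append (inp : ℕ → V → ℕ) (l₁ l₂ : List (Instr V)) (mem : ℕ → ℚ) :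
    run inp (l₁ ++ l₂) mem = run inp l₂ (run inp l₁ mem) := by
  simp [run]

theorem exec_of_jumpFree (inp : ℕ → V → ℕ) (s : Config) {i : Instr V} (hi : JumpFree i) :
    exec inp s i = ⟨s.pc + 1, effect inp s.mem i⟩ := by
  cases i <;> first | rfl | exact hi.elim

theorem iterate_step_of_jumpFree (inp : ℕ → V → ℕ) (prog : List (Instr V))
    (h : ∀ i ∈ prog, JumpFree i) (mem : ℕ → ℚ) (n : ℕ) (hn : n ≤ prog.length) :
    (step prog inp)^[n] ⟨0, mem⟩ = ⟨n, run inp (prog.take n) mem⟩ := by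
  induction n with
  | zero => simp [run]
  | succ n ih =>
    have hlt : n < prog.length := hn
    rw [Function.iterate_succ_apply', ih hlt.le, step]
    simp only [List.getElem?_eq_getElem hlt]
    rw [exec_of_jumpFree _ _ (h _ (List.getElem_mem hlt)), List.take_succ_eq_append_getElem hlt,
      run_append]
    rfl

/-- Every instruction is executed exactly once, so bounding running time reduces to counting
instructions. -/
theorem haltsWithin_of_jumpFree (inp : ℕ → V → ℕ) (prog : List (Instr V))
    (h : ∀ i ∈ prog, JumpFree i) (mem : ℕ → ℚ) {T : ℝ} (hT : (prog.length : ℝ) ≤ T) :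
    HaltsWithin prog inp mem T (run inp prog mem) :=
  ⟨prog.length, prog.length, hT, by
    rw [iterate_step_of_jumpFree inp prog h mem _ le_rfl, List.take_length], le_rfl⟩

/-- Arithmetic expressions in the input symbols and the contents of memory cells. -/
inductive Expr (V : Type*) where
  | const (c : ℕ)
  | read (i : ℕ) (v : V)
  | cell (a : ℕ)
  | add (a b : Expr V)
  | sub (a b : Expr V)
  | mul (a b : Expr V)
  | div (a b : Expr V)

namespace Expr

/-- The value of an expression. -/
def eval (inp : ℕ → V → ℕ) (mem : ℕ → ℚ) : Expr V → ℚ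
  | const c => c
  | read i v => inp i v
  | cell a => mem a
  | add a b => a.eval inp mem + b.eval inp mem
  | sub a b => a.eval inp mem - b.eval inp mem
  | mul a b => a.eval inp mem * b.eval inp mem
  | div a b => a.eval inp mem / b.eval inp mem

/-- A jump-free program that computes an expression in cell `r`, and uses no cells below `r` but
those that occur in the expression. -/
def compile : Expr V → ℕ → List (Instr V)
  | const c, r => [.const r c]
  | read i v, r => [.const r i, .read r r v]
  | cell a, r => [.const r 0, .add r r a]
  | add a b, r => a.compile r ++ (b.compile (r + 1) ++ [.add r r (r + 1)])
  | sub a b, r => a.compile r ++ (b.compile (r + 1) ++ [.sub r r (r + 1)])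
  | mul a b, r => a.compile r ++ (b.compile (r + 1) ++ [.mul r r (r + 1)])
  | div a b, r => a.compile r ++ (b.compile (r + 1) ++ [.div r r (r + 1)])

/-- The number of instructions that compute an expression. -/
def cost : Expr V → ℕ
  | const _ => 1
  | read _ _ => 2
  | cell _ => 2
  | add a b => a.cost + b.cost + 1
  | sub a b => a.cost + b.cost + 1
  | mul a b => a.cost + b.cost + 1
  | div a b => a.cost + b.cost + 1

/-- All memory cells that occur in the expression lie below `r`. -/
def CellsBelow (r : ℕ) : Expr V → Prop
  | const _ => True
  | read _ _ => True
  | cell a => a < r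
  | add a b => a.CellsBelow r ∧ b.CellsBelow r
  | sub a b => a.CellsBelow r ∧ b.CellsBelow r
  | mul a b => a.CellsBelow r ∧ b.CellsBelow r
  | div a b => a.CellsBelow r ∧ b.CellsBelow r

theorem CellsBelow.mono {r r' : ℕ} (hr : r ≤ r') {e : Expr V} (h : e.CellsBelow r) :
    e.CellsBelow r' := by
  induction e with
  | const | read => trivial
  | cell a => exact lt_of_lt_of_le h hr
  | add a b iha ihb | sub a b iha ihb | mul a b iha ihb | div a b iha ihb =>
    exact ⟨iha h.1, ihb h.2⟩

theorem eval_congr (inp : ℕ → V → ℕ) {mem mem' : ℕ → ℚ} {r : ℕ} {e : Expr V}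
    (h : e.CellsBelow r) (hm : ∀ a < r, mem' a = mem a) : e.eval inp mem' = e.eval inp mem := by
  induction e with
  | const | read => rfl
  | cell a => exact hm a h
  | add a b iha ihb | sub a b iha ihb | mul a b iha ihb | div a b iha ihb =>
    simp only [eval, iha h.1, ihb h.2]

theorem length_compile (e : Expr V) (r : ℕ) : (e.compile r).length = e.cost := by
  induction e generalizing r with
  | const | read | cell => rfl
  | add a b iha ihb | sub a b iha ihb | mul a b iha ihb | div a b iha ihb =>
    simp [compile, cost, iha, ihb, add_assoc]

theorem jumpFree_compile (e : Expr V) (r : ℕ) : ∀ i ∈ e.compile r, JumpFree i := by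
  induction e generalizing r with
  | const | read | cell => simp [compile, JumpFree]
  | add a b iha ihb | sub a b iha ihb | mul a b iha ihb | div a b iha ihb =>
    intro i hi
    simp only [compile, List.mem_append, List.mem_singleton] at hi
    rcases hi with hi | hi | rfl
    · exact iha _ i hi
    · exact ihb _ i hi
    · trivial

/-- The second conjunct carries the induction: the left operand leaves intact the cells that the
right one reads, and the right one, compiled at `r + 1`, leaves intact the left result in cell `r`.
-/
theorem run_compile (inp : ℕ → V → ℕ) (e : Expr V) (r : ℕ) (mem : ℕ → ℚ) (h : e.CellsBelow r) :
    run inp (e.compile r) mem r = e.eval inp mem ∧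
      ∀ a < r, run inp (e.compile r) mem a = mem a := by
  induction e generalizing r mem with
  | const c =>
    refine ⟨by simp [compile, run, effect, exec, eval], fun a ha => ?_⟩
    simp [compile, run, effect, exec, Function.update_of_ne ha.ne]
  | read i v =>
    refine ⟨by simp [compile, run, effect, exec, eval], fun a ha => ?_⟩
    simp [compile, run, effect, exec, Function.update_of_ne ha.ne]
  | cell b =>
    have hb : b ≠ r := ne_of_lt h
    refine ⟨by simp [compile, run, effect, exec, eval, Function.update_of_ne hb], fun a ha => ?_⟩
    simp [compile, run, effect, exec, Function.update_of_ne ha.ne]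
  | add a b iha ihb | sub a b iha ihb | mul a b iha ihb | div a b iha ihb =>
    obtain ⟨ha, ha'⟩ := iha r mem h.1
    obtain ⟨hb, hb'⟩ := ihb (r + 1) (run inp (a.compile r) mem) (h.2.mono r.le_succ)
    rw [eval_congr inp h.2 ha'] at hb
    refine ⟨?_, fun c hc => ?_⟩
    · simp only [compile, run_append, eval]
      rw [← hb, ← ha, ← hb' r r.lt_succ_self]
      simp [run, effect, exec]
    · simp only [compile, run_append]
      rw [← ha' c hc, ← hb' c (hc.trans r.lt_succ_self)]
      simp [run, effect, exec, Function.update_of_ne hc.ne]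

/-- The sum of a list of expressions. -/
def sum (l : List (Expr V)) : Expr V := l.foldr add (const 0)

/-- The product of a list of expressions. -/
def prod (l : List (Expr V)) : Expr V := l.foldr mul (const 1)

theorem eval_sum (inp : ℕ → V → ℕ) (mem : ℕ → ℚ) (l : List (Expr V)) :
    (sum l).eval inp mem = (l.map (eval inp mem)).sum := by
  induction l with
  | nil => simp [sum, eval]
  | cons a l ih =>
    rw [List.map_cons, List.sum_cons, ← ih]
    rfl

theorem eval_prod (inp : ℕ → V → ℕ) (mem : ℕ → ℚ) (l : List (Expr V)) :
    (prod l).eval inp mem = (l.map (eval inp mem)).prod := by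
  induction l with
  | nil => simp [prod, eval]
  | cons a l ih =>
    rw [List.map_cons, List.prod_cons, ← ih]
    rfl

theorem cost_sum_le {l : List (Expr V)} {c : ℕ} (h : ∀ e ∈ l, e.cost ≤ c) :
    (sum l).cost ≤ l.length * (c + 1) + 1 := by
  induction l with
  | nil => simp [sum, cost]
  | cons a l ih =>
    have h₁ := ih fun e he => h e (List.mem_cons_of_mem _ he)
    have h₂ := h a List.mem_cons_self
    have h₃ : (sum (a :: l)).cost = a.cost + (sum l).cost + 1 := rfl
    rw [h₃, List.length_cons, add_mul]
    omega

theorem cost_prod_le {l : List (Expr V)} {c : ℕ} (h : ∀ e ∈ l, e.cost ≤ c) :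
    (prod l).cost ≤ l.length * (c + 1) + 1 := by
  induction l with
  | nil => simp [prod, cost]
  | cons a l ih =>
    have h₁ := ih fun e he => h e (List.mem_cons_of_mem _ he)
    have h₂ := h a List.mem_cons_self
    have h₃ : (prod (a :: l)).cost = a.cost + (prod l).cost + 1 := rfl
    rw [h₃, List.length_cons, add_mul]
    omega

theorem cellsBelow_sum {r : ℕ} {l : List (Expr V)} (h : ∀ e ∈ l, e.CellsBelow r) :
    (sum l).CellsBelow r := by
  induction l with
  | nil => trivial
  | cons a l ih =>
    exact ⟨h a List.mem_cons_self, ih fun e he => h e (List.mem_cons_of_mem _ he)⟩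

theorem cellsBelow_prod {r : ℕ} {l : List (Expr V)} (h : ∀ e ∈ l, e.CellsBelow r) :
    (prod l).CellsBelow r := by
  induction l with
  | nil => trivial
  | cons a l ih =>
    exact ⟨h a List.mem_cons_self, ih fun e he => h e (List.mem_cons_of_mem _ he)⟩

/-- The expression with value `1` if the symbol with index `i` for `v` is number `c`, and `0`
otherwise; it relies on `0 / 0 = 0`. -/
def eqSymbol (i : ℕ) (v : V) (c : ℕ) : Expr V :=
  sub (const 1) (div (sub (read i v) (const c)) (sub (read i v) (const c)))

theorem eval_eqSymbol (inp : ℕ → V → ℕ) (mem : ℕ → ℚ) (i : ℕ) (v : V) (c : ℕ) :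
    (eqSymbol i v c).eval inp mem = if inp i v = c then 1 else 0 := by
  simp only [eqSymbol, eval]
  split_ifs with h
  · simp [h]
  · have : (inp i v : ℚ) - c ≠ 0 := sub_ne_zero.2 (by exact_mod_cast h)
    simp [div_self this]

/-- The program that computes the expressions of a list in the cells `r, r + 1, …`. -/
def compileList : List (Expr V) → ℕ → List (Instr V)
  | [], _ => []
  | e :: l, r => e.compile r ++ compileList l (r + 1)

theorem jumpFree_compileList (l : List (Expr V)) (r : ℕ) :
    ∀ i ∈ compileList l r, JumpFree i := by
  induction l generalizing r with
  | nil => simp [compileList]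
  | cons e l ih =>
    intro i hi
    rcases List.mem_append.1 hi with hi | hi
    exacts [jumpFree_compile e r i hi, ih _ i hi]

theorem length_compileList_le {l : List (Expr V)} {c : ℕ} (h : ∀ e ∈ l, e.cost ≤ c) (r : ℕ) :
    (compileList l r).length ≤ l.length * c := by
  induction l generalizing r with
  | nil => simp [compileList]
  | cons a l ih =>
    have h₁ := ih (fun e he => h e (List.mem_cons_of_mem _ he)) (r + 1)
    have h₂ := h a List.mem_cons_self
    rw [compileList, List.length_append, length_compile, List.length_cons, add_mul]
    omega

/-- `CellsBelow 0` says that the expressions read no memory at all, so the temporaries left by one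
of them cannot affect the next; the zero memory on the right is a placeholder. -/
theorem run_compileList (inp : ℕ → V → ℕ) (l : List (Expr V)) (h : ∀ e ∈ l, e.CellsBelow 0)
    (r : ℕ) (mem : ℕ → ℚ) :
    (∀ (i : ℕ) (hi : i < l.length),
      run inp (compileList l r) mem (r + i) = l[i].eval inp (fun _ => 0)) ∧
      ∀ a < r, run inp (compileList l r) mem a = mem a := by
  induction l generalizing r mem with
  | nil => simp [compileList, run]
  | cons e l ih =>
    obtain ⟨h₁, h₂⟩ := run_compile inp e r mem ((h e List.mem_cons_self).mono r.zero_le)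
    obtain ⟨h₃, h₄⟩ := ih (fun e he => h e (List.mem_cons_of_mem _ he)) (r + 1)
      (run inp (e.compile r) mem)
    refine ⟨fun i hi => ?_, fun a ha => ?_⟩
    · rw [compileList, run_append]
      cases i with
      | zero =>
        rw [add_zero, h₄ r r.lt_succ_self, h₁]
        exact eval_congr inp (h e List.mem_cons_self) fun a ha => absurd ha (Nat.not_lt_zero a)
      | succ i =>
        have := h₃ i (by simpa using hi)
        rw [show r + (i + 1) = r + 1 + i by omega, this, List.getElem_cons_succ]
    · rw [compileList, run_append, h₄ a (ha.trans r.lt_succ_self), h₂ a ha]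

end Expr

end RAM

/-! ### Chernoff bounds for independent samples from a finite distribution -/

section Concentration

variable {Ω : Type*} [Fintype Ω]

open Classical in
/-- The mass that `p` gives to the event `E`. -/
noncomputable def mass (p : Ω → ℝ) (E : Ω → Prop) : ℝ :=
  ∑ ω, if E ω then p ω else 0

open Classical in
/-- The empirical distribution of a sample sequence. -/
noncomputable def empirical {m : ℕ} (s : Fin m → Ω) (ω : Ω) : ℝ :=
  (∑ j, if s j = ω then 1 else 0) / m

open Classical in
theorem mass_empirical {m : ℕ} (s : Fin m → Ω) (E : Ω → Prop) :
    mass (empirical s) E = (∑ j, if E (s j) then 1 else 0) / m := by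
  have h : ∀ ω, (if E ω then empirical s ω else 0) =
      (∑ j, if s j = ω then (if E (s j) then (1 : ℝ) else 0) else 0) / m := fun ω => by
    split_ifs with hE
    · rw [empirical]
      congr 1
      refine Finset.sum_congr rfl fun j _ => ?_
      split_ifs with h₁ h₂
      · rfl
      · exact absurd (h₁ ▸ hE) h₂
      · rfl
    · rw [Finset.sum_eq_zero, zero_div]
      intro j _
      split_ifs with h₁ h₂
      · exact absurd (h₁ ▸ h₂) hE
      · rfl
      · rfl
  rw [mass, Finset.sum_congr rfl fun ω _ => h ω, ← Finset.sum_div, Finset.sum_comm]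
  simp

theorem mass_nonneg {p : Ω → ℝ} (hp : ∀ ω, 0 ≤ p ω) (E : Ω → Prop) : 0 ≤ mass p E :=
  Finset.sum_nonneg fun ω _ => by split_ifs <;> [exact hp ω; exact le_rfl]

theorem mass_mono {p : Ω → ℝ} (hp : ∀ ω, 0 ≤ p ω) {E E' : Ω → Prop} (h : ∀ ω, E ω → E' ω) :
    mass p E ≤ mass p E' := by
  refine Finset.sum_le_sum fun ω _ => ?_
  split_ifs with h₁ h₂ h₂
  exacts [le_rfl, absurd (h ω h₁) h₂, hp ω, le_rfl]

theorem mass_congr (p : Ω → ℝ) {E E' : Ω → Prop} (h : ∀ ω, E ω ↔ E' ω) : mass p E = mass p E' := by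
  rw [show E = E' from funext fun ω => propext (h ω)]

theorem iidProb_mono {p : Ω → ℝ} (hp : ∀ ω, 0 ≤ p ω) {m : ℕ} {E E' : (Fin m → Ω) → Prop}
    (h : ∀ s, E s → E' s) : iidProb p m E ≤ iidProb p m E' := by
  classical
  refine Finset.sum_le_sum_of_subset_of_nonneg (fun s hs => ?_)
    fun s _ _ => Finset.prod_nonneg fun i _ => hp _
  simp only [Finset.mem_filter, Finset.mem_univ, true_and] at hs ⊢
  exact h s hs

theorem sum_prod_eq_pow (f : Ω → ℝ) (m : ℕ) : ∑ s : Fin m → Ω, ∏ i, f (s i) = (∑ ω, f ω) ^ m := by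
  classical
  have := Finset.prod_univ_sum (fun _ : Fin m => (Finset.univ : Finset Ω)) (fun _ ω => f ω)
  rw [Fintype.piFinset_univ] at this
  rw [← this]
  simp

theorem iidProb_add_not {p : Ω → ℝ} (hp : IsDistribution p) {m : ℕ} (E : (Fin m → Ω) → Prop) :
    iidProb p m E + iidProb p m (fun s => ¬ E s) = 1 := by
  classical
  have := Finset.sum_filter_add_sum_filter_not Finset.univ E fun s => ∏ i, p (s i)
  rw [sum_prod_eq_pow, hp.2, one_pow] at this
  simp only [iidProb]
  convert this using 2

theorem iidProb_of_forall {p : Ω → ℝ} (hp : IsDistribution p) {m : ℕ} {E : (Fin m → Ω) → Prop}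
    (h : ∀ s, E s) : iidProb p m E = 1 := by
  rw [← iidProb_add_not hp E, left_eq_add, iidProb]
  simp [h]

theorem iidProb_exists_le {p : Ω → ℝ} (hp : ∀ ω, 0 ≤ p ω) {m : ℕ} {ι : Type*} [Fintype ι]
    (E : ι → (Fin m → Ω) → Prop) :
    iidProb p m (fun s => ∃ i, E i s) ≤ ∑ i, iidProb p m (E i) := by
  classical
  simp only [iidProb, Finset.sum_filter]
  rw [Finset.sum_comm]
  refine Finset.sum_le_sum fun s _ => ?_
  have h0 : 0 ≤ ∏ i, p (s i) := Finset.prod_nonneg fun i _ => hp _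
  have h1 : ∀ i ∈ Finset.univ, 0 ≤ if E i s then ∏ i, p (s i) else 0 := fun i _ => by
    split_ifs <;> [exact h0; exact le_rfl]
  split_ifs with h
  · obtain ⟨i, hi⟩ := h
    refine le_trans (le_of_eq ?_) (Finset.single_le_sum h1 (Finset.mem_univ i))
    rw [if_pos hi]
  · exact Finset.sum_nonneg h1

/-- Exponential Markov inequality: the indicator of the event is at most `exp (∑ j, f (s j) - a)`,
whose mean factors over the samples. -/
theorem iidProb_le_sum_exp {p : Ω → ℝ} (hp : ∀ ω, 0 ≤ p ω) (m : ℕ) (f : Ω → ℝ) (a : ℝ) :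
    iidProb p m (fun s => a ≤ ∑ j, f (s j)) ≤
      Real.exp (-a) * (∑ ω, p ω * Real.exp (f ω)) ^ m := by
  classical
  rw [iidProb, Finset.sum_filter, ← sum_prod_eq_pow, Finset.mul_sum]
  refine Finset.sum_le_sum fun s _ => ?_
  have h0 : 0 ≤ ∏ i, p (s i) := Finset.prod_nonneg fun i _ => hp _
  rw [Finset.prod_mul_distrib, ← Real.exp_sum, mul_left_comm, ← Real.exp_add]
  split_ifs with h
  · exact le_mul_of_one_le_right h0 (Real.one_le_exp (by linarith))
  · positivity

/-- The exponential moment bound behind both Chernoff bounds. -/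
theorem iidProb_deviation_le {p : Ω → ℝ} (hp : IsDistribution p) {m : ℕ} (hm : 0 < m) (E : Ω → Prop)
    {q t u b : ℝ} (hq : mass p E ≤ q) (hu : |u| ≤ 1) (hut : u ^ 2 = t ^ 2) :
    iidProb p m (fun s => b ≤ u * (m * mass (empirical s) E - m * mass p E)) ≤
      Real.exp (m * (q * t ^ 2) - b) := by
  classical
  have hm' : (m : ℝ) ≠ 0 := by positivity
  have h1 : ∀ s : Fin m → Ω, b ≤ u * (m * mass (empirical s) E - m * mass p E) ↔
      b + u * (m * mass p E) ≤ ∑ j, (fun ω => if E ω then u else 0) (s j) := fun s => by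
    have : ∑ j, (if E (s j) then u else 0) = u * (m * mass (empirical s) E) := by
      rw [mass_empirical, mul_div_cancel₀ _ hm', Finset.mul_sum]
      simp
    simp only [this]
    constructor <;> intro h <;> linarith
  refine (iidProb_mono hp.1 fun s hs => (h1 s).1 hs).trans
    ((iidProb_le_sum_exp hp.1 m (fun ω => if E ω then u else 0) _).trans ?_)
  have h2 : ∑ ω, p ω * Real.exp (if E ω then u else 0) = 1 + mass p E * (Real.exp u - 1) := by
    nth_rewrite 1 [← hp.2]
    rw [mass, Finset.sum_mul, ← Finset.sum_add_distrib]
    refine Finset.sum_congr rfl fun ω _ => ?_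
    split_ifs
    · ring
    · simp
  -- `exp u ≤ 1 + u + u ^ 2` on `|u| ≤ 1`. Only `u ^ 2` enters the error term, so one estimate
  -- serves both signs of `u`, that is, both tails.
  have h3 : Real.exp u - 1 ≤ u + t ^ 2 := by
    have := (abs_le.1 (Real.abs_exp_sub_one_sub_id_le hu)).2
    linarith
  have h0 := mass_nonneg hp.1 E
  have h4 : 1 + mass p E * (Real.exp u - 1) ≤ Real.exp (mass p E * u + q * t ^ 2) := by
    have h5 := Real.add_one_le_exp (mass p E * u + q * t ^ 2)
    have h6 := mul_le_mul_of_nonneg_left h3 h0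
    have h7 := mul_le_mul_of_nonneg_right hq (sq_nonneg t)
    linarith
  have h8 : 0 ≤ ∑ ω, p ω * Real.exp (if E ω then u else 0) :=
    Finset.sum_nonneg fun ω _ => mul_nonneg (hp.1 ω) (Real.exp_pos _).le
  rw [h2] at h8
  rw [h2]
  refine (mul_le_mul_of_nonneg_left (pow_le_pow_left₀ h8 h4 m) (Real.exp_pos _).le).trans ?_
  rw [← Real.exp_nat_mul, ← Real.exp_add]
  exact Real.exp_le_exp.2 (le_of_eq (by ring))

/-- Simultaneous Chernoff bounds for finitely many events. -/
theorem one_sub_le_iidProb_forall {p : Ω → ℝ} (hp : IsDistribution p) {m : ℕ} (hm : 0 < m)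
    {ι : Type*} [Fintype ι] (E : ι → Ω → Prop) (q : ι → ℝ) (hq : ∀ i, mass p (E i) ≤ q i)
    {β η : ℝ} (hβ : ∀ i, β ≤ q i) (hη : 0 ≤ η) (hη' : η ≤ 2) :
    1 - Fintype.card ι * (2 * Real.exp (-(m * β * η ^ 2 / 4))) ≤
      iidProb p m fun s => ∀ i, |mass (empirical s) (E i) - mass p (E i)| ≤ η * q i := by
  have hm' : (0 : ℝ) < m := by positivity
  have h2 : ∀ i, iidProb p m (fun s => ¬ |mass (empirical s) (E i) - mass p (E i)| ≤ η * q i) ≤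
      2 * Real.exp (-(m * β * η ^ 2 / 4)) := fun i => by
    -- The index `j` selects the tail. The value `u = η / 2` minimizes `m * q * u ^ 2 - u * m * η *
    -- q`, which becomes `-(m * q * η ^ 2 / 4)`; `η ≤ 2` ensures `|u| ≤ 1`.
    have h3 : ∀ s : Fin m → Ω, ¬ |mass (empirical s) (E i) - mass p (E i)| ≤ η * q i →
        ∃ j : Fin 2, η / 2 * (m * (η * q i)) ≤ (![η / 2, -(η / 2)] j) *
          (m * mass (empirical s) (E i) - m * mass p (E i)) := fun s hs => by
      rw [not_le, lt_abs] at hs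
      rcases hs with hs | hs
      · refine ⟨0, ?_⟩
        have := mul_le_mul_of_nonneg_left hs.le (mul_nonneg (div_nonneg hη two_pos.le) hm'.le)
        simp only [Matrix.cons_val_zero]
        linarith
      · refine ⟨1, ?_⟩
        have := mul_le_mul_of_nonneg_left hs.le (mul_nonneg (div_nonneg hη two_pos.le) hm'.le)
        simp only [Matrix.cons_val_one, Matrix.cons_val_zero]
        linarith
    refine (iidProb_mono hp.1 h3).trans ((iidProb_exists_le hp.1 _).trans ?_)
    rw [Fin.sum_univ_two, two_mul]
    have h4 : Real.exp (m * (q i * (η / 2) ^ 2) - η / 2 * (m * (η * q i))) ≤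
        Real.exp (-(m * β * η ^ 2 / 4)) := by
      refine Real.exp_le_exp.2 ?_
      have := mul_le_mul_of_nonneg_left (hβ i) (mul_nonneg hm'.le (sq_nonneg η))
      nlinarith
    have hab : |η / 2| ≤ 1 := by rw [abs_of_nonneg (by linarith)]; linarith
    refine add_le_add (le_trans ?_ h4) (le_trans ?_ h4)
    · exact iidProb_deviation_le hp hm (E i) (hq i) hab rfl
    · exact iidProb_deviation_le hp hm (E i) (hq i) (by simpa using hab) (by simp)
  have h5 := iidProb_add_not hp (m := m)
    fun s => ∀ i, |mass (empirical s) (E i) - mass p (E i)| ≤ η * q i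
  have h6 : iidProb p m (fun s => ¬ ∀ i, |mass (empirical s) (E i) - mass p (E i)| ≤ η * q i) ≤
      Fintype.card ι * (2 * Real.exp (-(m * β * η ^ 2 / 4))) := by
    simp only [not_forall]
    refine (iidProb_exists_le hp.1 _).trans ((Finset.sum_le_sum fun i _ => h2 i).trans ?_)
    simp
  linarith

end Concentration

/-! ### Topological order of the vertices -/

/-- By acyclicity, reachability is a partial order; extend it to a linear order and let the rank
count predecessors. -/
theorem ADMG.exists_rank {V : Type*} [Fintype V] (G : ADMG V) :
    ∃ r : V → ℕ, Function.Injective r ∧ ∀ a b, G.directed a b → r a < r b := by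
  classical
  have : IsPartialOrder V (Relation.ReflTransGen G.directed) :=
    { refl := fun _ => Relation.ReflTransGen.refl
      trans := fun _ _ _ => Relation.ReflTransGen.trans
      antisymm := fun a b hab hba => by
        rcases Relation.reflTransGen_iff_eq_or_transGen.1 hab with h | h
        · exact h.symm
        · exact absurd (h.trans_left hba) (G.acyclic a) }
  obtain ⟨s, hs, hle⟩ := extend_partialOrder (Relation.ReflTransGen G.directed)
  have hlt : ∀ a b, s a b → a ≠ b →
      (Finset.univ.filter fun u => s u a).card < (Finset.univ.filter fun u => s u b).card := by
    intro a b hab hne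
    refine Finset.card_lt_card (Finset.ssubset_iff_subset_ne.2 ⟨fun u hu => ?_, fun h => ?_⟩)
    · simp only [Finset.mem_filter, Finset.mem_univ, true_and] at hu ⊢
      exact hs.trans _ _ _ hu hab
    · have hb : b ∈ Finset.univ.filter fun u => s u a := by
        rw [h]
        simpa using hs.refl b
      exact hne (hs.antisymm _ _ hab (by simpa using hb))
  refine ⟨fun v => (Finset.univ.filter fun u => s u v).card, fun a b hab => ?_, fun a b hab => ?_⟩
  · by_contra hne
    rcases hs.total a b with h | h
    · exact (hlt a b h hne).ne hab
    · exact (hlt b a h (Ne.symm hne)).ne' hab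
  · refine hlt a b (hle _ _ (Relation.ReflTransGen.single hab)) ?_
    rintro rfl
    exact G.acyclic a (Relation.TransGen.single hab)

theorem filter_rank_succ {V : Type*} [DecidableEq V] {r : V → ℕ} (hr : Function.Injective r)
    {T : Finset V} {i : V} (hi : i ∈ T) :
    (T.filter fun v => r v < r i + 1) = insert i (T.filter fun v => r v < r i) := by
  ext v
  simp only [Finset.mem_filter, Finset.mem_insert]
  constructor
  · rintro ⟨hv, hlt⟩
    rcases (Nat.lt_succ_iff.1 hlt).eq_or_lt with h | h
    · exact Or.inl (hr h)
    · exact Or.inr ⟨hv, h⟩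
  · rintro (rfl | ⟨hv, h⟩)
    · exact ⟨hi, Nat.lt_succ_self _⟩
    · exact ⟨hv, by omega⟩

theorem filter_rank_le {V : Type*} [DecidableEq V] {r : V → ℕ} (hr : Function.Injective r)
    {T : Finset V} {i : V} (hi : i ∈ T) :
    (T.filter fun v => r i ≤ r v) = insert i (T.filter fun v => r i + 1 ≤ r v) := by
  ext v
  simp only [Finset.mem_filter, Finset.mem_insert]
  constructor
  · rintro ⟨hv, hlt⟩
    rcases hlt.eq_or_lt with h | h
    · exact Or.inl (hr h.symm)
    · exact Or.inr ⟨hv, h⟩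
  · rintro (rfl | ⟨hv, h⟩)
    · exact ⟨hi, le_rfl⟩
    · exact ⟨hv, by omega⟩

theorem filter_rank_succ_of_ne {V : Type*} {r : V → ℕ} {T : Finset V} {n : ℕ}
    (h : ∀ v ∈ T, r v ≠ n) : (T.filter fun v => r v < n + 1) = T.filter fun v => r v < n :=
  Finset.filter_congr fun v hv => by have := h v hv; omega

/-! ### Summing out a coordinate, and independence under a product measure -/

section Sums

variable {V : Type*} [Fintype V] [DecidableEq V] {A : Type*} [Fintype A] [DecidableEq A]

/-- The map `(σ, a) ↦ (Function.update σ i a, σ i)` is an involution. This lets a variable be summed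
out while all sums still run over full assignments, at the price of a factor `|A|`. -/
theorem sum_sum_update (i : V) (h : (V → A) → ℝ) :
    ∑ σ : V → A, ∑ a, h (Function.update σ i a) = Fintype.card A * ∑ σ, h σ := by
  have e : ∑ x : (V → A) × A, h (Function.update x.1 i x.2) = ∑ x : (V → A) × A, h x.1 := by
    let f : (V → A) × A → (V → A) × A := fun x => (Function.update x.1 i x.2, x.1 i)
    have hf : Function.Involutive f := fun x => by simp [f]
    exact Fintype.sum_equiv (hf.toPerm f) _ _ fun x => rfl
  rw [Fintype.sum_prod_type, Fintype.sum_prod_type] at e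
  simpa [Finset.mul_sum] using e

end Sums

/-- The product measure splits over the coordinates with and without `p`; freezing the irrelevant
block at `u₀` makes `f` and `g` functions of separate blocks. The product formula for integrals
holds without integrability. -/
theorem integral_mul_of_forall_eq {ι : Type*} [Fintype ι] {Ω : ι → Type*}
    [∀ i, MeasurableSpace (Ω i)] (μ : ∀ i, MeasureTheory.Measure (Ω i))
    [∀ i, MeasureTheory.IsProbabilityMeasure (μ i)] (p : ι → Prop) (f g : (∀ i, Ω i) → ℝ)
    (hf : ∀ u u', (∀ i, p i → u i = u' i) → f u = f u')
    (hg : ∀ u u', (∀ i, ¬ p i → u i = u' i) → g u = g u') :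
    ∫ u, f u * g u ∂MeasureTheory.Measure.pi μ =
      (∫ u, f u ∂MeasureTheory.Measure.pi μ) * ∫ u, g u ∂MeasureTheory.Measure.pi μ := by
  classical
  have : ∀ i, Nonempty (Ω i) := fun i => MeasureTheory.nonempty_of_isProbabilityMeasure (μ i)
  have u₀ : ∀ i, Ω i := fun i => Classical.arbitrary _
  set e := MeasurableEquiv.piEquivPiSubtypeProd Ω p with he
  have hmp := MeasureTheory.measurePreserving_piEquivPiSubtypeProd μ p
  have key : ∀ G : (∀ i, Ω i) → ℝ, ∫ u, G u ∂MeasureTheory.Measure.pi μ =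
      ∫ z, G (e.symm z) ∂((MeasureTheory.Measure.pi fun i : Subtype p => μ i).prod
        (MeasureTheory.Measure.pi fun i : {i // ¬ p i} => μ i)) := fun G =>
    ((hmp.symm e).integral_comp' G).symm
  have hf' : ∀ z, f (e.symm z) = f (e.symm (z.1, (e u₀).2)) := fun z =>
    hf _ _ fun i hi => by
      simp [he, MeasurableEquiv.piEquivPiSubtypeProd, Equiv.piEquivPiSubtypeProd, hi]
  have hg' : ∀ z, g (e.symm z) = g (e.symm ((e u₀).1, z.2)) := fun z =>
    hg _ _ fun i hi => by
      simp [he, MeasurableEquiv.piEquivPiSubtypeProd, Equiv.piEquivPiSubtypeProd, hi]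
  rw [key, key, key]
  simp_rw [hf', hg']
  rw [MeasureTheory.integral_prod_mul (fun a => f (e.symm (a, (e u₀).2)))
    (fun b => g (e.symm ((e u₀).1, b)))]
  -- With the constant `1` as the other factor, the same formula reduces each single integral to its
  -- own block.
  have h1 := MeasureTheory.integral_prod_mul
    (μ := MeasureTheory.Measure.pi fun i : Subtype p => μ i)
    (ν := MeasureTheory.Measure.pi fun i : {i // ¬ p i} => μ i)
    (fun a => f (e.symm (a, (e u₀).2))) (fun _ => (1 : ℝ))
  have h2 := MeasureTheory.integral_prod_mul
    (μ := MeasureTheory.Measure.pi fun i : Subtype p => μ i)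
    (ν := MeasureTheory.Measure.pi fun i : {i // ¬ p i} => μ i)
    (fun _ => (1 : ℝ)) (fun b => g (e.symm ((e u₀).1, b)))
  simp only [mul_one, one_mul, MeasureTheory.integral_const, MeasureTheory.probReal_univ,
    smul_eq_mul] at h1 h2
  rw [h1, h2]

/-! ### Partial laws: summing out and c-component factorization -/

namespace CausalBayesNet

variable {V : Type u} [Fintype V] [DecidableEq V] {G : ADMG V} {A : Type v} [Fintype A]
  [DecidableEq A] (M : CausalBayesNet.{u, v, w} G A)

instance : MeasureTheory.IsProbabilityMeasure M.hiddenLaw := by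
  unfold hiddenLaw
  infer_instance

/-- The probability of the values of the variables in `T` when all other variables are set by an
intervention. -/
noncomputable def partialLaw (T : Finset V) (σ : V → A) : ℝ :=
  ∫ u, ∏ v ∈ T, M.factor σ u v ∂M.hiddenLaw

theorem factor_nonneg (σ : V → A) (u : ∀ h, M.Val h) (v : V) : 0 ≤ M.factor σ u v :=
  M.mech_nonneg _ _ _ _

theorem factor_le_one (σ : V → A) (u : ∀ h, M.Val h) (v : V) : M.factor σ u v ≤ 1 := by
  rw [← M.mech_sum v (fun p => σ p.1) fun h => u h.1]
  exact Finset.single_le_sum (f := fun a => M.mech v (fun p => σ p.1) (fun h => u h.1) a)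
    (fun a _ => M.mech_nonneg _ _ _ _) (Finset.mem_univ (σ v))

theorem integrable_prod_factor (T : Finset V) (σ : V → A) :
    MeasureTheory.Integrable (fun u => ∏ v ∈ T, M.factor σ u v) M.hiddenLaw := by
  have hm : Measurable fun u => ∏ v ∈ T, M.factor σ u v := by
    refine Finset.measurable_prod _ fun v _ => ?_
    exact (M.measurable_mech v _ _).comp (measurable_pi_lambda _ fun h => measurable_pi_apply _)
  refine MeasureTheory.Integrable.of_bound hm.aestronglyMeasurable 1 (Filter.Eventually.of_forall
    fun u => ?_)
  rw [Real.norm_of_nonneg (Finset.prod_nonneg fun v _ => M.factor_nonneg σ u v)]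
  exact Finset.prod_le_one (fun v _ => M.factor_nonneg σ u v) fun v _ => M.factor_le_one σ u v

theorem partialLaw_nonneg (T : Finset V) (σ : V → A) : 0 ≤ M.partialLaw T σ :=
  MeasureTheory.integral_nonneg fun u => Finset.prod_nonneg fun v _ => M.factor_nonneg σ u v

theorem partialLaw_empty (σ : V → A) : M.partialLaw ∅ σ = 1 := by
  simp [partialLaw]

theorem factor_congr {σ σ' : V → A} {v : V} (hv : σ v = σ' v)
    (hp : ∀ p, G.directed p v → σ p = σ' p) (u : ∀ h, M.Val h) :
    M.factor σ u v = M.factor σ' u v := by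
  rw [factor, factor, hv, show (fun p : {p // G.directed p v} => σ p.1) = fun p => σ' p.1 from
    funext fun p => hp p.1 p.2]

theorem partialLaw_congr {T : Finset V} {σ σ' : V → A} (hv : ∀ v ∈ T, σ v = σ' v)
    (hp : ∀ v ∈ T, ∀ p, G.directed p v → σ p = σ' p) :
    M.partialLaw T σ = M.partialLaw T σ' := by
  unfold partialLaw
  congr 1
  funext u
  exact Finset.prod_congr rfl fun v hvT => M.factor_congr (hv v hvT) (hp v hvT) u

/-- Summing out a variable without children in `T`. -/
theorem sum_partialLaw_insert {T : Finset V} {i : V} (hi : i ∉ T)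
    (hc : ∀ v ∈ T, ¬ G.directed i v) (σ : V → A) :
    ∑ a, M.partialLaw (insert i T) (Function.update σ i a) = M.partialLaw T σ := by
  unfold partialLaw
  rw [← MeasureTheory.integral_finsetSum _ fun a _ => M.integrable_prod_factor _ _]
  congr 1
  funext u
  have h : ∀ a, ∏ v ∈ insert i T, M.factor (Function.update σ i a) u v =
      M.mech i (fun p => σ p.1) (fun h => u h.1) a * ∏ v ∈ T, M.factor σ u v := fun a => by
    rw [Finset.prod_insert hi]
    congr 1
    · rw [factor, Function.update_self]
      congr 1
      funext p
      refine Function.update_of_ne ?_ _ _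
      intro hp
      have := p.2
      rw [hp] at this
      exact G.acyclic i (Relation.TransGen.single this)
    · refine Finset.prod_congr rfl fun v hv => M.factor_congr ?_ (fun p hp => ?_) u
      · exact Function.update_of_ne (ne_of_mem_of_not_mem hv hi) _ _
      · refine Function.update_of_ne ?_ _ _
        rintro rfl
        exact hc v hv hp
  simp_rw [h]
  rw [← Finset.sum_mul, M.mech_sum, one_mul]

/-- The c-component factorization. -/
theorem partialLaw_mul (X : V) (T₁ T₂ : Finset V) (h₁ : T₁ ⊆ G.cComponent X)
    (h₂ : Disjoint T₂ (G.cComponent X)) :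
    M.partialLaw (T₁ ∪ T₂) = fun σ => M.partialLaw T₁ σ * M.partialLaw T₂ σ := by
  classical
  funext σ
  have hd : Disjoint T₁ T₂ := Finset.disjoint_of_subset_left h₁ h₂.symm
  simp only [partialLaw, Finset.prod_union hd]
  -- The two ends of a hidden variable are joined by a bidirected edge, so they lie in the same
  -- c-component. Hence the two products depend on disjoint sets of hidden variables.
  have hends : ∀ h, ∀ a ∈ M.ends h, ∀ b ∈ M.ends h, a ∈ G.cComponent X → b ∈ G.cComponent X := by
    intro h a ha b hb haX
    by_cases hab : a = b
    · exact hab ▸ haX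
    · have hmem : M.ends h ∈ G.bidirected.edgeSet := M.range_ends ▸ Set.mem_range_self h
      rw [(Sym2.mem_and_mem_iff hab).1 ⟨ha, hb⟩, SimpleGraph.mem_edgeSet] at hmem
      simp only [ADMG.cComponent, Finset.mem_filter, Finset.mem_univ, true_and] at haX ⊢
      exact haX.trans hmem.reachable
  refine integral_mul_of_forall_eq M.prior (fun h => ∃ a ∈ M.ends h, a ∈ G.cComponent X) _ _
    (fun u u' huu => ?_) fun u u' huu => ?_
  · refine Finset.prod_congr rfl fun v hv => ?_
    rw [factor, factor]
    congr 1
    funext h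
    exact huu h.1 ⟨v, h.2, h₁ hv⟩
  · refine Finset.prod_congr rfl fun v hv => ?_
    rw [factor, factor]
    congr 1
    funext h
    refine huu h.1 ?_
    rintro ⟨a, ha, haX⟩
    exact Finset.disjoint_left.1 h₂ hv (hends h.1 a ha v h.2 haX)

theorem obs_eq_partialLaw : M.obs = M.partialLaw Finset.univ := rfl

theorem sum_mul_partialLaw_insert {T : Finset V} {i : V} (hi : i ∉ T)
    (hc : ∀ v ∈ T, ¬ G.directed i v) (f : (V → A) → ℝ)
    (hf : ∀ σ a, f (Function.update σ i a) = f σ) :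
    (∑ σ, f σ * M.partialLaw (insert i T) σ) * Fintype.card A =
      ∑ σ, f σ * M.partialLaw T σ := by
  rw [mul_comm, ← sum_sum_update i]
  refine Finset.sum_congr rfl fun σ _ => ?_
  simp_rw [hf]
  rw [← Finset.mul_sum, M.sum_partialLaw_insert hi hc]

/-- Summing out all variables of rank at least `n`. -/
theorem sum_mul_partialLaw {r : V → ℕ} (hr : Function.Injective r)
    (hdir : ∀ a b, G.directed a b → r a < r b) (f : (V → A) → ℝ) (D : Finset V) (n : ℕ)
    (hf : ∀ i ∈ D, n ≤ r i → ∀ σ a, f (Function.update σ i a) = f σ) :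
    (∑ σ, f σ * M.partialLaw D σ) * (Fintype.card A : ℝ) ^ (D.filter fun v => n ≤ r v).card =
      ∑ σ, f σ * M.partialLaw (D.filter fun v => r v < n) σ := by
  -- Induction on the distance from `n` to the top rank: the hypothesis for `n + 1` removes all
  -- later variables, and then a variable of rank `n` has no children left.
  obtain ⟨N, hN⟩ : ∃ N, ∀ v ∈ D, r v < N + n :=
    ⟨D.sup r + 1, fun v hv => by have := Finset.le_sup (f := r) hv; omega⟩
  induction N generalizing n with
  | zero =>
    rw [zero_add] at hN
    rw [Finset.filter_false_of_mem fun v hv => not_le.2 (hN v hv),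
      Finset.filter_true_of_mem fun v hv => hN v hv]
    simp
  | succ N ih =>
    have h₁ := ih (n + 1) (fun i hi hn => hf i hi (by omega)) fun v hv => by
      have := hN v hv
      omega
    by_cases hi : ∃ i ∈ D, r i = n
    · obtain ⟨i, hiD, rfl⟩ := hi
      have h₂ := M.sum_mul_partialLaw_insert (T := D.filter fun v => r v < r i) (i := i) (by simp)
        (fun v hv hd => by
          have := hdir _ _ hd
          simp only [Finset.mem_filter] at hv
          omega) f (hf i hiD le_rfl)
      rw [← h₂, ← filter_rank_succ hr hiD, ← h₁, filter_rank_le hr hiD, Finset.card_insert_of_notMem (by simp), pow_succ, mul_assoc]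
    · have hne : ∀ v ∈ D, r v ≠ n := fun v hv h => hi ⟨v, hv, h⟩
      rw [← filter_rank_succ_of_ne hne, ← h₁,
        show (D.filter fun v => n ≤ r v) = D.filter fun v => n + 1 ≤ r v from
          Finset.filter_congr fun v hv => by have := hne v hv; omega]

theorem isDistribution_obs [Nonempty A] : IsDistribution M.obs := by
  obtain ⟨r, hr, hdir⟩ := G.exists_rank
  refine ⟨M.partialLaw_nonneg _, ?_⟩
  have h := M.sum_mul_partialLaw hr hdir (fun _ => 1) Finset.univ 0 fun _ _ _ _ _ => rfl
  simp only [one_mul, Nat.zero_le, Finset.filter_true, Nat.not_lt_zero, Finset.filter_false,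
    partialLaw_empty, Finset.sum_const, Finset.card_univ, Fintype.card_fun, nsmul_eq_mul,
    mul_one, Nat.cast_pow] at h
  have hs : (Fintype.card A : ℝ) ≠ 0 := by exact_mod_cast Fintype.card_ne_zero
  exact mul_right_cancel₀ (pow_ne_zero _ hs) (h.trans (one_mul _).symm)

theorem interv_nonneg (X : V) (x : A) (σ : V → A) : 0 ≤ M.interv X x σ := by
  unfold interv
  split_ifs
  exacts [M.partialLaw_nonneg _ σ, le_rfl]

/-- The indicator of `σ X = x` does not depend on the other coordinates, so these can all be summed
out; what remains is to count the assignments with `σ X = x`. -/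
theorem sum_interv [Nonempty A] (X : V) (x : A) : ∑ σ, M.interv X x σ = 1 := by
  obtain ⟨r, hr, hdir⟩ := G.exists_rank
  have h := M.sum_mul_partialLaw hr hdir (fun σ => if σ X = x then 1 else 0)
    (Finset.univ.erase X) 0 fun i hi _ σ a => by
      rw [Function.update_of_ne (Finset.ne_of_mem_erase hi).symm]
  have h' := sum_sum_update X fun σ : V → A => if σ X = x then (1 : ℝ) else 0
  simp only [Function.update_self, Finset.sum_ite_eq', Finset.mem_univ, if_true, Finset.sum_const,
    Finset.card_univ, Fintype.card_fun, nsmul_eq_mul, mul_one, Nat.cast_pow] at h'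
  simp only [Nat.zero_le, Finset.filter_true, Nat.not_lt_zero, Finset.filter_false,
    partialLaw_empty, mul_one, Finset.card_erase_of_mem (Finset.mem_univ X),
    Finset.card_univ] at h
  have hs : (Fintype.card A : ℝ) ≠ 0 := by exact_mod_cast Fintype.card_ne_zero
  have hV : Fintype.card V - 1 + 1 = Fintype.card V :=
    Nat.sub_add_cancel (Fintype.card_pos_iff.2 ⟨X⟩)
  have e : ∑ σ, M.interv X x σ =
      ∑ σ : V → A, (if σ X = x then 1 else 0) * M.partialLaw (Finset.univ.erase X) σ :=
    Finset.sum_congr rfl fun σ _ => by rw [interv, ite_mul, one_mul, zero_mul]; rfl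
  rw [e]
  refine mul_right_cancel₀ (pow_ne_zero (Fintype.card V) hs) ?_
  rw [one_mul]
  conv_lhs => rw [← hV]
  rw [pow_succ, ← mul_assoc, h, h', mul_comm]

end CausalBayesNet

/-! ### The plug-in functional -/

section Estimator

variable {V : Type*} [Fintype V] [DecidableEq V] {A : Type*} [Fintype A] [DecidableEq A]

/-- The probability of agreeing with `τ` on `S`. -/
noncomputable def cyl (p : (V → A) → ℝ) (S : Finset V) (τ : V → A) : ℝ :=
  mass p fun σ => ∀ v ∈ S, σ v = τ v

/-- The product, over `v ∈ S`, of the conditional probabilities of the value of `v` given the values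
of the variables in `Z` of smaller rank. -/
noncomputable def chainProd (r : V → ℕ) (S Z : Finset V) (p : (V → A) → ℝ) (τ : V → A) : ℝ :=
  ∏ v ∈ S, cyl p (Z.filter fun u => r u < r v + 1) τ / cyl p (Z.filter fun u => r u < r v) τ

/-- The density of the interventional with respect to the observational distribution. -/
noncomputable def density (r : V → ℕ) (S Z : Finset V) (X : V) (p : (V → A) → ℝ) (τ : V → A) : ℝ :=
  (∑ a, chainProd r S Z p (Function.update τ X a)) / chainProd r S Z p τ

/-- The probability of agreeing with `ρ` on `F` and with `τ` on `Z`. -/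
noncomputable def joint (p : (V → A) → ℝ) (F Z : Finset V) (ρ τ : V → A) : ℝ :=
  mass p fun σ => (∀ v ∈ F, σ v = ρ v) ∧ ∀ v ∈ Z, σ v = τ v

/-- Extension of an assignment by the constant value `x`. -/
def extend (x : A) {S : Finset V} (w : S → A) (v : V) : A :=
  if h : v ∈ S then w ⟨v, h⟩ else x

theorem extend_mem (x : A) {S : Finset V} (w : S → A) {v : V} (h : v ∈ S) :
    extend x w v = w ⟨v, h⟩ :=
  dif_pos h

theorem forall_eq_extend_iff (x : A) {S : Finset V} (w : S → A) (σ : V → A) :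
    (∀ v ∈ S, σ v = extend x w v) ↔ (fun v : S => σ v) = w := by
  constructor
  · intro h
    funext v
    rw [h v v.2, extend_mem x w v.2]
  · rintro rfl v hv
    rw [extend_mem x _ hv]

/-- The plug-in functional for the interventional distribution of the variables in `F`. -/
noncomputable def plugIn (r : V → ℕ) (S Z F : Finset V) (X : V) (x : A) (p : (V → A) → ℝ)
    (w : F → A) : ℝ :=
  ∑ z : Z → A with extend x z X = x,
    joint p F Z (extend x w) (extend x z) * density r S Z X p (extend x z)

theorem cyl_congr (p : (V → A) → ℝ) {S : Finset V} {τ τ' : V → A} (h : ∀ v ∈ S, τ v = τ' v) :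
    cyl p S τ = cyl p S τ' :=
  mass_congr p fun σ => forall₂_congr fun v hv => by rw [h v hv]

theorem chainProd_congr (r : V → ℕ) (S Z : Finset V) (p : (V → A) → ℝ) {τ τ' : V → A}
    (h : ∀ v ∈ Z, τ v = τ' v) : chainProd r S Z p τ = chainProd r S Z p τ' :=
  Finset.prod_congr rfl fun v _ => by
    rw [cyl_congr p fun u hu => h u (Finset.mem_of_mem_filter u hu),
      cyl_congr p fun u hu => h u (Finset.mem_of_mem_filter u hu)]

theorem density_congr (r : V → ℕ) (S Z : Finset V) (X : V) (p : (V → A) → ℝ) {τ τ' : V → A}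
    (h : ∀ v ∈ Z, τ v = τ' v) : density r S Z X p τ = density r S Z X p τ' := by
  unfold density
  rw [chainProd_congr r S Z p h]
  congr 1
  refine Finset.sum_congr rfl fun a _ => chainProd_congr r S Z p fun v hv => ?_
  by_cases hX : v = X
  · subst hX
    simp
  · rw [Function.update_of_ne hX, Function.update_of_ne hX, h v hv]

/-- Any sum over assignments to `Z` of joint probabilities is a sum over full assignments. -/
theorem sum_joint_mul (p : (V → A) → ℝ) (F Z : Finset V) (x : A) (ρ : V → A) (f : (V → A) → ℝ)
    (hf : ∀ τ τ', (∀ v ∈ Z, τ v = τ' v) → f τ = f τ') :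
    ∑ z : Z → A, joint p F Z ρ (extend x z) * f (extend x z) =
      ∑ σ, if ∀ v ∈ F, σ v = ρ v then p σ * f σ else 0 := by
  classical
  simp only [joint, mass, Finset.sum_mul]
  rw [Finset.sum_comm]
  refine Finset.sum_congr rfl fun σ _ => ?_
  rw [Finset.sum_eq_single fun v : Z => σ v]
  · have h : ∀ v ∈ Z, σ v = extend x (fun v : Z => σ v) v :=
      (forall_eq_extend_iff x _ σ).2 rfl
    split_ifs with h₁ h₂ h₂
    · rw [hf _ σ fun v hv => (h v hv).symm]
    · exact absurd h₁.1 h₂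
    · exact absurd ⟨h₂, h⟩ h₁
    · rw [zero_mul]
  · intro z _ hz
    rw [if_neg, zero_mul]
    rintro ⟨-, h⟩
    exact hz ((forall_eq_extend_iff x z σ).1 h).symm
  · simp

/-- Both the density and, because `X ∈ Z`, the condition at `X` depend only on the coordinates in
`Z`. Grouping full assignments by their restriction to `Z` is therefore harmless. -/
theorem plugIn_eq (r : V → ℕ) (S Z F : Finset V) {X : V} (hX : X ∈ Z) (x : A)
    (p : (V → A) → ℝ) (w : F → A) :
    plugIn r S Z F X x p w =
      marginal F (fun σ => if σ X = x then p σ * density r S Z X p σ else 0) w := by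
  have h := sum_joint_mul p F Z x (extend x w)
    (fun τ => if τ X = x then density r S Z X p τ else 0) fun τ τ' hτ => by
      rw [hτ X hX, density_congr r S Z X p hτ]
  rw [plugIn, Finset.sum_filter, marginal, Finset.sum_filter]
  simp only [mul_ite, mul_zero] at h
  rw [h]
  refine Finset.sum_congr rfl fun σ _ => ?_
  simp only [forall_eq_extend_iff]

end Estimator

theorem ADMG.mem_cComponent_self {V : Type*} [Fintype V] (G : ADMG V) (X : V) :
    X ∈ G.cComponent X := by
  simp [cComponent]

/-! ### Identification of the interventional distribution -/

namespace CausalBayesNet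

variable {V : Type u} [Fintype V] [DecidableEq V] {G : ADMG V} {A : Type v} [Fintype A]
  [DecidableEq A] (M : CausalBayesNet.{u, v, w} G A) {r : V → ℕ}

/-- The factor of the cylinder probabilities that does not come from the c-component of `X`. -/
noncomputable def coFactor (r : V → ℕ) (X : V) (n : ℕ) (τ : V → A) : ℝ :=
  (∑ σ, (if ∀ v ∈ (G.paPlus (G.cComponent X)).filter fun u => r u < n, σ v = τ v then 1 else 0) *
    M.partialLaw ((G.cComponent X)ᶜ.filter fun u => r u < n) σ) /
      (Fintype.card A : ℝ) ^ (Finset.univ.filter fun v => n ≤ r v).card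

/-- After summing out all ranks from `n` on, the rest factors along the c-component. The part inside
it depends only on its vertices of rank below `n` and their parents; these lie in `Z` below `n`, so
this part is constant on the cylinder and comes out of the sum. -/
theorem cyl_obs_eq [Nonempty A] (hr : Function.Injective r)
    (hdir : ∀ a b, G.directed a b → r a < r b) (X : V) (n : ℕ) (τ : V → A) :
    cyl M.obs ((G.paPlus (G.cComponent X)).filter fun u => r u < n) τ =
      M.partialLaw ((G.cComponent X).filter fun u => r u < n) τ * M.coFactor r X n τ := by
  have hs : (Fintype.card A : ℝ) ^ (Finset.univ.filter fun v => n ≤ r v).card ≠ 0 :=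
    pow_ne_zero _ (by exact_mod_cast Fintype.card_ne_zero)
  set S := G.cComponent X with hS
  set Z := G.paPlus S with hZ
  have hSZ : S ⊆ Z := Finset.subset_union_left
  have h := M.sum_mul_partialLaw hr hdir
    (fun σ => if ∀ v ∈ Z.filter fun u => r u < n, σ v = τ v then 1 else 0) Finset.univ n
    fun i _ hi σ a => by
      have : (∀ v ∈ Z.filter fun u => r u < n, Function.update σ i a v = τ v) ↔
          ∀ v ∈ Z.filter fun u => r u < n, σ v = τ v := forall₂_congr fun v hv => by
        rw [Function.update_of_ne]
        rintro rfl
        simp only [Finset.mem_filter] at hv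
        omega
      simp only [this]
  have e₁ : cyl M.obs (Z.filter fun u => r u < n) τ =
      ∑ σ, (if ∀ v ∈ Z.filter fun u => r u < n, σ v = τ v then 1 else 0) *
        M.partialLaw Finset.univ σ := by
    classical
    rw [cyl, mass]
    refine Finset.sum_congr rfl fun σ _ => ?_
    rw [ite_mul, one_mul, zero_mul, obs_eq_partialLaw]
    congr
  have e₂ : (Finset.univ.filter fun u => r u < n) =
      (S.filter fun u => r u < n) ∪ Sᶜ.filter fun u => r u < n := by
    rw [← Finset.filter_union, Finset.union_compl]
  rw [e₁, ← mul_right_inj' hs, mul_comm, h, e₂, M.partialLaw_mul X _ _ (Finset.filter_subset _ _)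
    (Finset.disjoint_of_subset_left (Finset.filter_subset _ _) disjoint_compl_left),
    coFactor, ← hS, ← hZ, mul_left_comm, mul_div_cancel₀ _ hs, Finset.mul_sum]
  refine Finset.sum_congr rfl fun σ _ => ?_
  rw [mul_left_comm]
  split_ifs with hσ
  · congr 1
    refine M.partialLaw_congr (fun v hv => hσ v ?_) fun v hv p hp => hσ p ?_
    · simp only [Finset.mem_filter] at hv ⊢
      exact ⟨hSZ hv.1, hv.2⟩
    · simp only [Finset.mem_filter] at hv ⊢
      refine ⟨Finset.mem_union_right _ (Finset.mem_biUnion.2 ⟨v, hv.1, ?_⟩),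
        (hdir p v hp).trans hv.2⟩
      simpa [ADMG.parents] using hp
  · simp

/-- Passing `i` adds no vertex to the complement's part, only the constraint `σ i = τ i`. That part
does not depend on `σ i`, as children of `i` have larger rank; so the sum shrinks by `|A|`, exactly
as the normalization does. -/
theorem coFactor_succ [Nonempty A] (hr : Function.Injective r)
    (hdir : ∀ a b, G.directed a b → r a < r b) {X i : V} (hi : i ∈ G.cComponent X) (τ : V → A) :
    M.coFactor r X (r i + 1) τ = M.coFactor r X (r i) τ := by
  have hs : (Fintype.card A : ℝ) ≠ 0 := by exact_mod_cast Fintype.card_ne_zero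
  unfold coFactor
  set S := G.cComponent X with hS
  set Z := G.paPlus S with hZ
  have hSZ : S ⊆ Z := Finset.subset_union_left
  rw [filter_rank_succ hr (hSZ hi), filter_rank_le hr (Finset.mem_univ i),
    filter_rank_succ_of_ne (T := Sᶜ) fun v hv h => by simp [hr h, hi] at hv,
    Finset.card_insert_of_notMem (by simp), pow_succ, div_eq_div_iff (by positivity) (by positivity),
    mul_comm _ (Fintype.card A : ℝ), ← mul_assoc]
  congr 1
  rw [mul_comm, ← sum_sum_update i]
  refine Finset.sum_congr rfl fun σ _ => ?_
  have hu : ∀ a, M.partialLaw (Sᶜ.filter fun u => r u < r i) (Function.update σ i a) =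
      M.partialLaw (Sᶜ.filter fun u => r u < r i) σ := fun a =>
    M.partialLaw_congr
      (fun v hv => Function.update_of_ne (by
        rintro rfl
        simp at hv) _ _)
      fun v hv p hp => Function.update_of_ne (by
        rintro rfl
        have := hdir _ _ hp
        simp only [Finset.mem_filter] at hv
        omega) _ _
  have ht : ∀ a, (∀ v ∈ insert i (Z.filter fun u => r u < r i), Function.update σ i a v = τ v) ↔
      (a = τ i ∧ ∀ v ∈ Z.filter fun u => r u < r i, σ v = τ v) := fun a => by
    rw [Finset.forall_mem_insert, Function.update_self]
    refine and_congr_right fun _ => forall₂_congr fun v hv => ?_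
    rw [Function.update_of_ne]
    rintro rfl
    simp at hv
  simp_rw [hu, ht]
  rw [← Finset.sum_mul]
  congr 1
  simp only [ite_and, Finset.sum_ite_eq', Finset.mem_univ, if_true]

/-- In each conditional probability the cofactors of numerator and denominator agree by
`coFactor_succ` and cancel, leaving a quotient of consecutive partial laws; the product telescopes.
-/
theorem partialLaw_eq_prod [Nonempty A] (hr : Function.Injective r)
    (hdir : ∀ a b, G.directed a b → r a < r b) (X : V) (τ : V → A)
    (hτ : 0 < cyl M.obs (G.paPlus (G.cComponent X)) τ) (n : ℕ) :
    M.partialLaw ((G.cComponent X).filter fun u => r u < n) τ =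
      ∏ v ∈ (G.cComponent X).filter fun u => r u < n,
        cyl M.obs ((G.paPlus (G.cComponent X)).filter fun u => r u < r v + 1) τ /
          cyl M.obs ((G.paPlus (G.cComponent X)).filter fun u => r u < r v) τ := by
  induction n with
  | zero => simp [partialLaw_empty]
  | succ n ih =>
    by_cases hn : ∃ i ∈ G.cComponent X, r i = n
    · obtain ⟨i, hi, rfl⟩ := hn
      have hpos : 0 < cyl M.obs ((G.paPlus (G.cComponent X)).filter fun u => r u < r i) τ :=
        hτ.trans_le (mass_mono M.isDistribution_obs.1 fun σ hσ v hv =>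
          hσ v (Finset.mem_of_mem_filter v hv))
      have hb := M.cyl_obs_eq hr hdir X (r i) τ
      have hb' := M.cyl_obs_eq hr hdir X (r i + 1) τ
      rw [M.coFactor_succ hr hdir hi] at hb'
      have hne : M.partialLaw ((G.cComponent X).filter fun u => r u < r i) τ ≠ 0 ∧
          M.coFactor r X (r i) τ ≠ 0 := by
        rw [hb] at hpos
        exact mul_ne_zero_iff.1 hpos.ne'
      conv_rhs => rw [filter_rank_succ hr hi, Finset.prod_insert (by simp), ← ih, hb', hb]
      rw [mul_div_mul_right _ _ hne.2, div_mul_cancel₀ _ hne.1]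
    · have hne : ∀ v ∈ G.cComponent X, r v ≠ n := fun v hv h => hn ⟨v, hv, h⟩
      rw [filter_rank_succ_of_ne hne, ih]

theorem partialLaw_cComponent [Nonempty A] (hr : Function.Injective r)
    (hdir : ∀ a b, G.directed a b → r a < r b) (X : V) (τ : V → A)
    (hτ : 0 < cyl M.obs (G.paPlus (G.cComponent X)) τ) :
    M.partialLaw (G.cComponent X) τ =
      chainProd r (G.cComponent X) (G.paPlus (G.cComponent X)) M.obs τ := by
  have h := M.partialLaw_eq_prod hr hdir X τ hτ (Finset.univ.sup r + 1)
  rwa [Finset.filter_true_of_mem fun v _ =>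
    Nat.lt_succ_of_le (Finset.le_sup (f := r) (Finset.mem_univ v))] at h

theorem obs_eq_mul (X : V) (σ : V → A) :
    M.obs σ = M.partialLaw (G.cComponent X) σ * M.partialLaw (G.cComponent X)ᶜ σ := by
  have h := congrFun (M.partialLaw_mul X (G.cComponent X) (G.cComponent X)ᶜ subset_rfl
    disjoint_compl_left) σ
  rwa [Finset.union_compl] at h

/-- Identification of the interventional distribution. -/
theorem interv_eq [Nonempty A] (hr : Function.Injective r)
    (hdir : ∀ a b, G.directed a b → r a < r b) {X : V} (hX : G.Identifiable X)
    (hpos : ∀ τ, 0 < cyl M.obs (G.paPlus (G.cComponent X)) τ) (x : A) (σ : V → A) :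
    M.interv X x σ = if σ X = x then
      M.obs σ * density r (G.cComponent X) (G.paPlus (G.cComponent X)) X M.obs σ else 0 := by
  unfold interv
  split_ifs
  · have hne : M.partialLaw (G.cComponent X) σ ≠ 0 := by
      have h := M.cyl_obs_eq hr hdir X (Finset.univ.sup r + 1) σ
      have hall : ∀ v, r v < Finset.univ.sup r + 1 := fun v =>
        Nat.lt_succ_of_le (Finset.le_sup (f := r) (Finset.mem_univ v))
      rw [Finset.filter_true_of_mem fun v _ => hall v,
        Finset.filter_true_of_mem fun v _ => hall v] at h
      have := hpos σ
      rw [h] at this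
      exact (mul_ne_zero_iff.1 this.ne').1
    have h₁ : (Finset.univ : Finset V).erase X =
        (G.cComponent X).erase X ∪ (G.cComponent X)ᶜ := by
      ext v
      have := G.mem_cComponent_self X
      by_cases hv : v = X
      · subst hv
        simp [this]
      · by_cases h : v ∈ G.cComponent X <;> simp [hv, h]
    have h₂ := congrFun (M.partialLaw_mul X ((G.cComponent X).erase X) (G.cComponent X)ᶜ
      (Finset.erase_subset _ _) disjoint_compl_left) σ
    -- Identifiability enters here: without a child in its c-component, `X` can be summed out of the
    -- law of that component.
    have h₃ := M.sum_partialLaw_insert (Finset.notMem_erase X (G.cComponent X))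
      (fun v hv hd => hX v hd (Finset.mem_of_mem_erase hv)) σ
    rw [Finset.insert_erase (G.mem_cComponent_self X)] at h₃
    change M.partialLaw (Finset.univ.erase X) σ = _
    rw [h₁, h₂, ← h₃, M.obs_eq_mul X σ, density,
      ← M.partialLaw_cComponent hr hdir X σ (hpos σ)]
    simp_rw [← M.partialLaw_cComponent hr hdir X _ (hpos _)]
    field_simp
  · rfl

theorem plugIn_obs [Nonempty A] (hr : Function.Injective r)
    (hdir : ∀ a b, G.directed a b → r a < r b) {X : V} (hX : G.Identifiable X)
    (hpos : ∀ τ, 0 < cyl M.obs (G.paPlus (G.cComponent X)) τ) (F : Finset V) (x : A) :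
    plugIn r (G.cComponent X) (G.paPlus (G.cComponent X)) F X x M.obs =
      marginal F (M.interv X x) := by
  funext w
  rw [plugIn_eq r _ (G.paPlus (G.cComponent X)) F
      (Finset.mem_union_left _ (G.mem_cComponent_self X)),
    show M.interv X x = _ from funext (M.interv_eq hr hdir hX hpos x)]

end CausalBayesNet

/-! ### Multiplicative closeness, and normalization -/

section Close

/-- `a` and `b` are positive and agree up to the factor `exp t`. -/
def Close (t a b : ℝ) : Prop :=
  0 < a ∧ 0 < b ∧ a ≤ Real.exp t * b ∧ b ≤ Real.exp t * a

namespace Close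

variable {t t' a b a' b' : ℝ}

theorem one : Close 0 1 1 := by
  simp [Close]

theorem mul (h : Close t a b) (h' : Close t' a' b') : Close (t + t') (a * a') (b * b') := by
  obtain ⟨ha, hb, h₁, h₂⟩ := h
  obtain ⟨ha', hb', h₁', h₂'⟩ := h'
  refine ⟨mul_pos ha ha', mul_pos hb hb', ?_, ?_⟩
  · rw [Real.exp_add, mul_mul_mul_comm]
    exact mul_le_mul h₁ h₁' ha'.le (by positivity)
  · rw [Real.exp_add, mul_mul_mul_comm]
    exact mul_le_mul h₂ h₂' hb'.le (by positivity)

theorem inv (h : Close t a b) : Close t a⁻¹ b⁻¹ := by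
  obtain ⟨ha, hb, h₁, h₂⟩ := h
  refine ⟨inv_pos.2 ha, inv_pos.2 hb, ?_, ?_⟩
  · rw [← div_eq_mul_inv, inv_eq_one_div, div_le_div_iff₀ ha hb, one_mul]
    exact h₂
  · rw [← div_eq_mul_inv, inv_eq_one_div, div_le_div_iff₀ hb ha, one_mul]
    exact h₁

theorem div (h : Close t a b) (h' : Close t' a' b') : Close (t + t') (a / a') (b / b') := by
  rw [div_eq_mul_inv, div_eq_mul_inv]
  exact h.mul h'.inv

theorem prod {ι : Type*} {s : Finset ι} {f g : ι → ℝ} (h : ∀ i ∈ s, Close t (f i) (g i)) :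
    Close (s.card * t) (∏ i ∈ s, f i) (∏ i ∈ s, g i) := by
  classical
  induction s using Finset.induction_on with
  | empty => simpa using one
  | insert i s hi ih =>
    rw [Finset.prod_insert hi, Finset.prod_insert hi, Finset.card_insert_of_notMem hi]
    have := (h i (Finset.mem_insert_self i s)).mul
      (ih fun j hj => h j (Finset.mem_insert_of_mem hj))
    convert this using 1
    push_cast
    ring

theorem sum {ι : Type*} {s : Finset ι} (hs : s.Nonempty) {f g : ι → ℝ}
    (h : ∀ i ∈ s, Close t (f i) (g i)) : Close t (∑ i ∈ s, f i) (∑ i ∈ s, g i) := by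
  refine ⟨Finset.sum_pos (fun i hi => (h i hi).1) hs, Finset.sum_pos (fun i hi => (h i hi).2.1) hs,
    ?_, ?_⟩
  · rw [Finset.mul_sum]
    exact Finset.sum_le_sum fun i hi => (h i hi).2.2.1
  · rw [Finset.mul_sum]
    exact Finset.sum_le_sum fun i hi => (h i hi).2.2.2

/-- The lower bound on `a` needs `(1 - η) * (1 + 2 * η) ≥ 1`, which is where `η ≤ 1 / 2` is used. -/
theorem of_abs_sub_le {η : ℝ} (hη : 0 ≤ η) (hη' : η ≤ 1 / 2) (hb : 0 < b)
    (h : |a - b| ≤ η * b) : Close (2 * η) a b := by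
  obtain ⟨h₁, h₂⟩ := abs_le.1 h
  have he := Real.add_one_le_exp (2 * η)
  have ha : 0 < a := by nlinarith
  refine ⟨ha, hb, ?_, ?_⟩
  · nlinarith [mul_le_mul_of_nonneg_right he hb.le]
  · have h₃ := mul_le_mul_of_nonneg_right he ha.le
    have h₄ : (1 - η) * b * (2 * η + 1) ≤ a * (2 * η + 1) :=
      mul_le_mul_of_nonneg_right (by linarith) (by linarith)
    have h₅ : 0 ≤ b * (η * (1 - 2 * η)) := by
      have : 0 ≤ 1 - 2 * η := by linarith
      positivity
    nlinarith

theorem abs_sub_le {γ : ℝ} (h : Close t a b) (ht : Real.exp t ≤ 1 + γ) : |a - b| ≤ γ * b := by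
  obtain ⟨ha, hb, h₁, h₂⟩ := h
  have h₃ := mul_le_mul_of_nonneg_right ht hb.le
  have h₄ := mul_le_mul_of_nonneg_right ht ha.le
  rw [abs_le]
  constructor
  · rcases le_or_gt a b with hab | hab
    · have hγ : 0 ≤ γ := by
        by_contra hγ
        have := mul_neg_of_neg_of_pos (not_le.1 hγ) ha
        linarith
      have := mul_le_mul_of_nonneg_left hab hγ
      linarith
    · have hγ : 0 ≤ γ := by
        by_contra hγ
        have := mul_neg_of_neg_of_pos (not_le.1 hγ) hb
        linarith
      have := mul_nonneg hγ hb.le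
      linarith
  · linarith

end Close

end Close

/-- The total mass of `g` is within `e` of `1`, so rescaling moves `g` by at most another `e` in
`L¹`; the factor `1 / 2` in `tvDist` absorbs the doubling. -/
theorem isDistribution_div_sum {Ω : Type*} [Fintype Ω] {p g : Ω → ℝ} (hp : IsDistribution p)
    (hg : ∀ w, 0 ≤ g w) {e : ℝ} (he : ∑ w, |p w - g w| ≤ e) (he' : e < 1) :
    IsDistribution (fun w => g w / ∑ w', g w') ∧
      tvDist p (fun w => g w / ∑ w', g w') ≤ e := by
  have h₁ : |1 - ∑ w, g w| ≤ e := by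
    rw [← hp.2, ← Finset.sum_sub_distrib]
    exact (Finset.abs_sum_le_sum_abs _ _).trans he
  have hpos : 0 < ∑ w, g w := by linarith [(abs_le.1 h₁).2]
  refine ⟨⟨fun w => div_nonneg (hg w) hpos.le, ?_⟩, ?_⟩
  · rw [← Finset.sum_div, div_self hpos.ne']
  · have h₂ : ∑ w, |g w - g w / ∑ w', g w'| = |1 - ∑ w, g w| := by
      have : ∀ w, |g w - g w / ∑ w', g w'| = g w * |1 - 1 / ∑ w', g w'| := fun w => by
        rw [← abs_of_nonneg (hg w), ← abs_mul, abs_of_nonneg (hg w)]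
        congr 1
        ring
      simp_rw [this]
      rw [← Finset.sum_mul]
      nth_rewrite 1 [← abs_of_pos hpos]
      rw [← abs_mul, mul_sub, mul_one, mul_one_div_cancel hpos.ne', abs_sub_comm]
    have h₃ : ∑ w, |p w - g w / ∑ w', g w'| ≤ ∑ w, (|p w - g w| + |g w - g w / ∑ w', g w'|) :=
      Finset.sum_le_sum fun w _ => abs_sub_le _ _ _
    rw [Finset.sum_add_distrib, h₂] at h₃
    rw [tvDist]
    linarith

/-! ### Stability of the plug-in functional -/

section Estimator

variable {V : Type*} [Fintype V] [DecidableEq V] {A : Type*} [Fintype A] [DecidableEq A]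

theorem sum_joint (p : (V → A) → ℝ) (F Z : Finset V) (x : A) (τ : V → A) :
    ∑ w : F → A, joint p F Z (extend x w) τ = cyl p Z τ := by
  classical
  simp only [joint, cyl, mass, forall_eq_extend_iff]
  rw [Finset.sum_comm]
  refine Finset.sum_congr rfl fun σ _ => ?_
  simp only [ite_and, Finset.sum_ite_eq, Finset.mem_univ, if_true]
  congr

theorem sum_cyl_mul (p : (V → A) → ℝ) (Z : Finset V) (x : A) (f : (V → A) → ℝ)
    (hf : ∀ τ τ', (∀ v ∈ Z, τ v = τ' v) → f τ = f τ') :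
    ∑ z : Z → A, cyl p Z (extend x z) * f (extend x z) = ∑ σ, p σ * f σ := by
  have h := sum_joint_mul p ∅ Z x (fun _ => x) f hf
  have e : ∀ τ : V → A, joint p ∅ Z (fun _ => x) τ = cyl p Z τ := fun τ =>
    mass_congr p fun σ => by simp
  simpa [e] using h

theorem cyl_eq_sum (p : (V → A) → ℝ) {Z Z' : Finset V} (hZ : Z' ⊆ Z) (x : A) (τ : V → A) :
    cyl p Z' τ = ∑ z : Z → A with (∀ v ∈ Z', extend x z v = τ v), cyl p Z (extend x z) := by
  classical
  have h := sum_cyl_mul p Z x (fun σ => if ∀ v ∈ Z', σ v = τ v then 1 else 0)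
    fun τ₁ τ₂ h => by
      have : (∀ v ∈ Z', τ₁ v = τ v) ↔ ∀ v ∈ Z', τ₂ v = τ v :=
        forall₂_congr fun v hv => by rw [h v (hZ hv)]
      simp only [this]
  rw [Finset.sum_filter]
  simp only [mul_ite, mul_one, mul_zero] at h
  rw [h, cyl, mass]
  congr!

theorem cyl_extend (p : (V → A) → ℝ) (S : Finset V) (x : A) (τ : V → A) :
    cyl p S τ = cyl p S (extend x fun v : S => τ v) :=
  cyl_congr p ((forall_eq_extend_iff x _ τ).2 rfl)

variable {p q : (V → A) → ℝ} {F Z S : Finset V} {X : V} {x : A} {r : V → ℕ} {η : ℝ}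

/-- Summing over the `|A| ^ F.card` assignments `w` cancels the denominator and gives relative error
`η` on cylinders over `Z`; relative errors survive addition, hence pass to coarser cylinders. -/
theorem abs_cyl_sub_le
    (h : ∀ (w : F → A) (z : Z → A),
      |joint q F Z (extend x w) (extend x z) - joint p F Z (extend x w) (extend x z)| ≤
        η / (Fintype.card A : ℝ) ^ F.card * cyl p Z (extend x z))
    {Z' : Finset V} (hZ : Z' ⊆ Z) (τ : V → A) : |cyl q Z' τ - cyl p Z' τ| ≤ η * cyl p Z' τ := by
  have : Nonempty A := ⟨x⟩
  have hs : (Fintype.card A : ℝ) ^ F.card ≠ 0 :=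
    pow_ne_zero _ (Nat.cast_ne_zero.2 Fintype.card_ne_zero)
  have h₁ : ∀ z : Z → A, |cyl q Z (extend x z) - cyl p Z (extend x z)| ≤
      η * cyl p Z (extend x z) := fun z => by
    rw [← sum_joint q F Z x, ← sum_joint p F Z x (extend x z), ← Finset.sum_sub_distrib]
    refine (Finset.abs_sum_le_sum_abs _ _).trans ((Finset.sum_le_sum fun w _ => h w z).trans ?_)
    rw [sum_joint, Finset.sum_const, Finset.card_univ, Fintype.card_fun, Fintype.card_coe,
      nsmul_eq_mul, Nat.cast_pow, ← mul_assoc, mul_div_cancel₀ _ hs]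
  rw [cyl_eq_sum q hZ x, cyl_eq_sum p hZ x τ, ← Finset.sum_sub_distrib, Finset.mul_sum]
  exact (Finset.abs_sum_le_sum_abs _ _).trans (Finset.sum_le_sum fun z _ => h₁ z)

/-- Each cylinder probability is right up to `exp (2 * η)`, each quotient of two up to `exp (4 *
η)`. A chain product multiplies `S.card` of them, and the density is a sum of chain products over
another one. -/
theorem close_density (hη : 0 ≤ η) (hη' : η ≤ 1 / 2)
    (hp : ∀ Z' ⊆ Z, ∀ τ, 0 < cyl p Z' τ)
    (h : ∀ Z' ⊆ Z, ∀ τ, |cyl q Z' τ - cyl p Z' τ| ≤ η * cyl p Z' τ) (τ : V → A) :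
    Close (8 * S.card * η) (density r S Z X q τ) (density r S Z X p τ) := by
  have h₁ : ∀ τ, Close (4 * S.card * η) (chainProd r S Z q τ) (chainProd r S Z p τ) := fun τ => by
    have := Close.prod (t := 2 * η + 2 * η) (s := S) fun v _ =>
      (Close.of_abs_sub_le hη hη' (hp _ (Finset.filter_subset (fun u => r u < r v + 1) Z) τ)
        (h _ (Finset.filter_subset _ Z) τ)).div
      (Close.of_abs_sub_le hη hη' (hp _ (Finset.filter_subset (fun u => r u < r v) Z) τ)
        (h _ (Finset.filter_subset _ Z) τ))
    rw [show 4 * (S.card : ℝ) * η = S.card * (2 * η + 2 * η) by ring]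
    exact this
  have h₂ := (Close.sum ⟨τ X, Finset.mem_univ _⟩ fun a _ => h₁ (Function.update τ X a)).div (h₁ τ)
  rw [show 8 * (S.card : ℝ) * η = 4 * S.card * η + 4 * S.card * η by ring]
  exact h₂

/-- The plug-in functional is stable under small relative perturbations. -/
theorem sum_abs_plugIn_sub_le {γ : ℝ} (hη : 0 ≤ η) (hη' : η ≤ 1 / 2)
    (hp : ∀ Z' ⊆ Z, ∀ τ, 0 < cyl p Z' τ) (hp0 : ∀ σ, 0 ≤ p σ)
    (h : ∀ (w : F → A) (z : Z → A),
      |joint q F Z (extend x w) (extend x z) - joint p F Z (extend x w) (extend x z)| ≤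
        η / (Fintype.card A : ℝ) ^ F.card * cyl p Z (extend x z))
    (hγ : Real.exp (8 * S.card * η) ≤ 1 + γ) (h1 : ∑ w, plugIn r S Z F X x p w = 1) :
    ∑ w, |plugIn r S Z F X x p w - plugIn r S Z F X x q w| ≤ η * (1 + γ) + γ := by
  have : Nonempty A := ⟨x⟩
  have hs : (Fintype.card A : ℝ) ^ F.card ≠ 0 :=
    pow_ne_zero _ (Nat.cast_ne_zero.2 Fintype.card_ne_zero)
  have hc := close_density (r := r) (S := S) (X := X) hη hη' hp fun Z' hZ τ =>
    abs_cyl_sub_le h hZ τ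
  -- The error of the joint probability is measured against `cyl p Z`, since the joint probability
  -- itself may vanish; the error of the density is relative.
  have ht : ∀ (w : F → A) (z : Z → A),
      |joint p F Z (extend x w) (extend x z) * density r S Z X p (extend x z) -
        joint q F Z (extend x w) (extend x z) * density r S Z X q (extend x z)| ≤
      η / (Fintype.card A : ℝ) ^ F.card * (1 + γ) *
        (cyl p Z (extend x z) * density r S Z X p (extend x z)) +
      γ * (joint p F Z (extend x w) (extend x z) * density r S Z X p (extend x z)) := by
    intro w z
    have c := hc (extend x z)
    have hd := c.abs_sub_le hγ
    have hj := h w z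
    have hj0 : 0 ≤ joint p F Z (extend x w) (extend x z) := mass_nonneg hp0 _
    have hq : density r S Z X q (extend x z) ≤ (1 + γ) * density r S Z X p (extend x z) :=
      c.2.2.1.trans (mul_le_mul_of_nonneg_right hγ c.2.1.le)
    calc _ = |-((joint q F Z (extend x w) (extend x z) - joint p F Z (extend x w) (extend x z)) *
          density r S Z X q (extend x z)) - joint p F Z (extend x w) (extend x z) *
          (density r S Z X q (extend x z) - density r S Z X p (extend x z))| := by
          congr 1
          ring
      _ ≤ |joint q F Z (extend x w) (extend x z) - joint p F Z (extend x w) (extend x z)| *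
          density r S Z X q (extend x z) + joint p F Z (extend x w) (extend x z) *
          |density r S Z X q (extend x z) - density r S Z X p (extend x z)| := by
          refine (abs_sub _ _).trans (le_of_eq ?_)
          rw [abs_neg, abs_mul, abs_mul, abs_of_pos c.1, abs_of_nonneg hj0]
      _ ≤ (η / (Fintype.card A : ℝ) ^ F.card * cyl p Z (extend x z)) *
          ((1 + γ) * density r S Z X p (extend x z)) +
          joint p F Z (extend x w) (extend x z) * (γ * density r S Z X p (extend x z)) :=
          add_le_add (mul_le_mul hj hq c.1.le ((abs_nonneg _).trans hj))
            (mul_le_mul_of_nonneg_left hd hj0)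
      _ = _ := by ring
  -- This sum is the total mass of the functional, so the non-relative error contributes only `η /
  -- |A| ^ F.card * (1 + γ)` for each `w`.
  have h2 : ∑ z : Z → A with extend x z X = x,
      cyl p Z (extend x z) * density r S Z X p (extend x z) = 1 := by
    rw [← h1]
    unfold plugIn
    rw [Finset.sum_comm]
    refine Finset.sum_congr rfl fun z _ => ?_
    rw [← Finset.sum_mul, sum_joint]
  have hw : ∀ w : F → A, |plugIn r S Z F X x p w - plugIn r S Z F X x q w| ≤
      η / (Fintype.card A : ℝ) ^ F.card * (1 + γ) + γ * plugIn r S Z F X x p w := fun w => by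
    unfold plugIn
    rw [← Finset.sum_sub_distrib]
    refine (Finset.abs_sum_le_sum_abs _ _).trans ((Finset.sum_le_sum fun z _ => ht w z).trans ?_)
    rw [Finset.sum_add_distrib, ← Finset.mul_sum, ← Finset.mul_sum, h2, mul_one]
  refine (Finset.sum_le_sum fun w _ => hw w).trans (le_of_eq ?_)
  rw [Finset.sum_add_distrib, ← Finset.mul_sum _ _ γ, h1, Finset.sum_const, Finset.card_univ,
    Fintype.card_fun, Fintype.card_coe, nsmul_eq_mul, Nat.cast_pow, ← mul_assoc,
    mul_div_cancel₀ _ hs, mul_one]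

theorem plugIn_nonneg (hq : ∀ σ, 0 ≤ q σ) (w : F → A) : 0 ≤ plugIn r S Z F X x q w := by
  have h : ∀ τ, 0 ≤ chainProd r S Z q τ := fun τ =>
    Finset.prod_nonneg fun v _ => div_nonneg (mass_nonneg hq _) (mass_nonneg hq _)
  exact Finset.sum_nonneg fun z _ => mul_nonneg (mass_nonneg hq _)
    (div_nonneg (Finset.sum_nonneg fun a _ => h _) (h _))

end Estimator

/-! ### The learning and evaluation programs, and their lengths -/

namespace RAM

variable {V : Type*} [Fintype V] [DecidableEq V] {A : Type*} [Fintype A] [DecidableEq A]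

theorem code_injective : Function.Injective (code : A → ℕ) := fun _ _ h =>
  (Fintype.equivFin A).injective (Fin.val_injective h)

namespace Expr

/-- The expression with value `1` if sample `j` agrees with `τ` on `T`, and `0` otherwise. -/
noncomputable def agree (j : ℕ) (T : Finset V) (τ : V → A) : Expr V :=
  prod (T.toList.map fun v => eqSymbol j v (code (τ v)))

/-- The expression for the empirical probability of a cylinder set. -/
noncomputable def freq (m : ℕ) (T : Finset V) (τ : V → A) : Expr V :=
  div (sum ((List.finRange m).map fun j : Fin m => agree j T τ)) (const m)

/-- The expression for the empirical joint probability. -/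
noncomputable def jointFreq (m : ℕ) (F Z : Finset V) (ρ τ : V → A) : Expr V :=
  div (sum ((List.finRange m).map fun j : Fin m => mul (agree j F ρ) (agree j Z τ))) (const m)

/-- The expression for `chainProd`. -/
noncomputable def chain (m : ℕ) (r : V → ℕ) (S Z : Finset V) (τ : V → A) : Expr V :=
  prod (S.toList.map fun v =>
    div (freq m (Z.filter fun u => r u < r v + 1) τ) (freq m (Z.filter fun u => r u < r v) τ))

/-- The expression for `density`. -/
noncomputable def dens (m : ℕ) (r : V → ℕ) (S Z : Finset V) (X : V) (τ : V → A) : Expr V :=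
  div (sum ((Finset.univ : Finset A).toList.map fun a => chain m r S Z (Function.update τ X a)))
    (chain m r S Z τ)

/-- The expression for `plugIn`. -/
noncomputable def plug (m : ℕ) (r : V → ℕ) (S Z F : Finset V) (X : V) (x : A) (w : F → A) :
    Expr V :=
  sum ((Finset.univ.filter fun z : Z → A => extend x z X = x).toList.map fun z =>
    mul (jointFreq m F Z (extend x w) (extend x z)) (dens m r S Z X (extend x z)))

theorem eval_agree (inp : ℕ → V → ℕ) (mem : ℕ → ℚ) (j : ℕ) (T : Finset V) (τ : V → A) :
    (agree j T τ).eval inp mem = if ∀ v ∈ T, inp j v = code (τ v) then 1 else 0 := by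
  rw [agree, eval_prod, List.map_map, Finset.prod_map_toList]
  simp only [Function.comp_def, eval_eqSymbol]
  rw [Finset.prod_ite_zero, Finset.prod_const_one]
  congr

variable {m : ℕ} (s : Fin m → V → A) (mem : ℕ → ℚ)

theorem eval_agree_sample (j : Fin m) (T : Finset V) (τ : V → A) :
    (agree (j : ℕ) T τ).eval (sampleInput s) mem = if ∀ v ∈ T, s j v = τ v then 1 else 0 := by
  rw [eval_agree]
  simp only [sampleInput, j.2, dite_true, Fin.eta, code_injective.eq_iff]

theorem eval_freq (T : Finset V) (τ : V → A) :
    ((freq m T τ).eval (sampleInput s) mem : ℝ) = cyl (empirical s) T τ := by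
  classical
  rw [cyl, mass_empirical]
  simp only [freq, eval, eval_sum, List.map_map, Function.comp_def, eval_agree_sample,
    ← Fin.sum_univ_def]
  push_cast
  congr! 2
  split_ifs <;> simp

theorem eval_jointFreq (F Z : Finset V) (ρ τ : V → A) :
    ((jointFreq m F Z ρ τ).eval (sampleInput s) mem : ℝ) = joint (empirical s) F Z ρ τ := by
  classical
  rw [joint, mass_empirical]
  simp only [jointFreq, eval, eval_sum, List.map_map, Function.comp_def, eval_agree_sample,
    ← Fin.sum_univ_def]
  push_cast
  congr! 2
  split_ifs <;> simp_all

theorem eval_chain (r : V → ℕ) (S Z : Finset V) (τ : V → A) :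
    ((chain m r S Z τ).eval (sampleInput s) mem : ℝ) = chainProd r S Z (empirical s) τ := by
  simp only [chain, chainProd, eval_prod, List.map_map, Finset.prod_map_toList, Function.comp_def,
    eval, Rat.cast_prod, Rat.cast_div, eval_freq]

theorem eval_dens (r : V → ℕ) (S Z : Finset V) (X : V) (τ : V → A) :
    ((dens m r S Z X τ).eval (sampleInput s) mem : ℝ) = density r S Z X (empirical s) τ := by
  simp only [dens, density, eval_sum, List.map_map, Finset.sum_map_toList, Function.comp_def,
    eval, Rat.cast_sum, Rat.cast_div, eval_chain]

theorem eval_plug (r : V → ℕ) (S Z F : Finset V) (X : V) (x : A) (w : F → A) :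
    ((plug m r S Z F X x w).eval (sampleInput s) mem : ℝ) =
      plugIn r S Z F X x (empirical s) w := by
  simp only [plug, plugIn, eval_sum, List.map_map, Finset.sum_map_toList, Function.comp_def,
    eval, Rat.cast_sum, Rat.cast_mul, eval_jointFreq, eval_dens]

theorem cellsBelow_agree (j : ℕ) (T : Finset V) (τ : V → A) (n : ℕ) :
    (agree j T τ).CellsBelow n :=
  cellsBelow_prod (List.forall_mem_map.2 fun _ _ => ⟨trivial, ⟨trivial, trivial⟩, trivial, trivial⟩)

theorem cellsBelow_freq (T : Finset V) (τ : V → A) (n : ℕ) : (freq m T τ).CellsBelow n :=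
  ⟨cellsBelow_sum (List.forall_mem_map.2 fun _ _ => cellsBelow_agree _ _ _ _), trivial⟩

theorem cellsBelow_chain (r : V → ℕ) (S Z : Finset V) (τ : V → A) (n : ℕ) :
    (chain m r S Z τ).CellsBelow n :=
  cellsBelow_prod (List.forall_mem_map.2 fun _ _ => ⟨cellsBelow_freq _ _ _, cellsBelow_freq _ _ _⟩)

theorem cellsBelow_plug (r : V → ℕ) (S Z F : Finset V) (X : V) (x : A) (w : F → A) (n : ℕ) :
    (plug m r S Z F X x w).CellsBelow n :=
  cellsBelow_sum (List.forall_mem_map.2 fun _ _ =>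
    ⟨⟨cellsBelow_sum (List.forall_mem_map.2 fun _ _ =>
      ⟨cellsBelow_agree _ _ _ _, cellsBelow_agree _ _ _ _⟩), trivial⟩,
    cellsBelow_sum (List.forall_mem_map.2 fun _ _ => cellsBelow_chain _ _ _ _ _),
    cellsBelow_chain _ _ _ _ _⟩)

theorem cost_agree_le (j : ℕ) (T : Finset V) (τ : V → A) :
    (agree j T τ).cost ≤ 12 * T.card + 1 := by
  -- `11` is the exact cost of `eqSymbol`.
  refine (cost_prod_le (c := 11) (List.forall_mem_map.2 fun v _ => le_rfl)).trans (le_of_eq ?_)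
  rw [List.length_map, Finset.length_toList]
  ring

variable {N : ℕ}

theorem cost_freq_le (hm : 1 ≤ m) (hN : 1 ≤ N) {T : Finset V} (hT : T.card ≤ N) (τ : V → A) :
    (freq m T τ).cost ≤ 17 * (m * N) := by
  have h := cost_sum_le (l := (List.finRange m).map fun j : Fin m => agree (j : ℕ) T τ)
    (c := 12 * N + 1)
    (List.forall_mem_map.2 fun j _ => (cost_agree_le _ T τ).trans (by omega))
  rw [List.length_map, List.length_finRange] at h
  have : (freq m T τ).cost =
    (sum ((List.finRange m).map fun j : Fin m => agree (j : ℕ) T τ)).cost + 1 + 1 := rfl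
  rw [this]
  nlinarith [Nat.mul_le_mul hm hN, Nat.mul_le_mul_left m hN]

theorem cost_jointFreq_le (hm : 1 ≤ m) (hN : 1 ≤ N) {F Z : Finset V} (hT : F.card + Z.card ≤ N)
    (ρ τ : V → A) : (jointFreq m F Z ρ τ).cost ≤ 19 * (m * N) := by
  have h := cost_sum_le
    (l := (List.finRange m).map fun j : Fin m => mul (agree (j : ℕ) F ρ) (agree (j : ℕ) Z τ))
    (c := 12 * N + 3) (List.forall_mem_map.2 fun j _ => by
      have h₁ := cost_agree_le (j : ℕ) F ρ
      have h₂ := cost_agree_le (j : ℕ) Z τ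
      have h₃ : (mul (agree (j : ℕ) F ρ) (agree (j : ℕ) Z τ)).cost =
        (agree (j : ℕ) F ρ).cost + (agree (j : ℕ) Z τ).cost + 1 := rfl
      omega)
  rw [List.length_map, List.length_finRange] at h
  have : (jointFreq m F Z ρ τ).cost = (sum ((List.finRange m).map fun j : Fin m =>
    mul (agree (j : ℕ) F ρ) (agree (j : ℕ) Z τ))).cost + 1 + 1 := rfl
  rw [this]
  nlinarith [Nat.mul_le_mul hm hN, Nat.mul_le_mul_left m hN]

theorem cost_chain_le (hm : 1 ≤ m) (hN : 1 ≤ N) {S Z : Finset V} (hZ : Z.card ≤ N)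
    (hS : 1 ≤ S.card) (r : V → ℕ) (τ : V → A) :
    (chain m r S Z τ).cost ≤ 37 * (S.card * (m * N)) := by
  have h := cost_prod_le (l := S.toList.map fun v =>
    div (freq m (Z.filter fun u => r u < r v + 1) τ) (freq m (Z.filter fun u => r u < r v) τ))
    (c := 34 * (m * N) + 1) (List.forall_mem_map.2 fun v _ => by
      have h₁ := cost_freq_le hm hN
        ((Finset.card_filter_le Z fun u => r u < r v + 1).trans hZ) τ
      have h₂ := cost_freq_le hm hN ((Finset.card_filter_le Z fun u => r u < r v).trans hZ) τ
      have h₃ : (div (freq m (Z.filter fun u => r u < r v + 1) τ)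
        (freq m (Z.filter fun u => r u < r v) τ)).cost =
        (freq m (Z.filter fun u => r u < r v + 1) τ).cost +
          (freq m (Z.filter fun u => r u < r v) τ).cost + 1 := rfl
      omega)
  rw [List.length_map, Finset.length_toList] at h
  have h₁ := Nat.mul_le_mul hm hN
  have h₂ := Nat.mul_le_mul_left S.card h₁
  have h₃ := Nat.mul_le_mul hS h₁
  refine h.trans ?_
  nlinarith

/-- The factors account for the assignments `z` together with the values summed at `X`, the vertices
of `S`, the samples, and the symbols compared in each sample. Nothing is shared between
subexpressions. -/
theorem cost_plug_le (hm : 1 ≤ m) (hN : 1 ≤ N) {S Z F : Finset V} (hT : F.card + Z.card ≤ N)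
    (hS : 1 ≤ S.card) (r : V → ℕ) (X : V) (x : A) (w : F → A) :
    (plug m r S Z F X x w).cost ≤
      99 * (Fintype.card A ^ (Z.card + 1) * (S.card * (m * N))) := by
  have : Nonempty A := ⟨x⟩
  have hs : 1 ≤ Fintype.card A := Fintype.card_pos
  have hZ : Z.card ≤ N := by omega
  set Q := S.card * (m * N) with hQ
  have hmN : m * N ≤ Q := Nat.le_mul_of_pos_left _ hS
  have hQ1 : 1 ≤ Q := (Nat.mul_le_mul hm hN).trans hmN
  have hsQ : Q ≤ Fintype.card A * Q := Nat.le_mul_of_pos_left _ hs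
  have hc := fun τ : V → A => cost_chain_le hm hN hZ hS r τ
  have hd : ∀ τ : V → A, (dens m r S Z X τ).cost ≤ 77 * (Fintype.card A * Q) := fun τ => by
    have h := cost_sum_le (l := (Finset.univ : Finset A).toList.map fun a =>
      chain m r S Z (Function.update τ X a)) (c := 37 * Q) (List.forall_mem_map.2 fun a _ => hc _)
    rw [List.length_map, Finset.length_toList, Finset.card_univ] at h
    have h₂ : (dens m r S Z X τ).cost = (sum ((Finset.univ : Finset A).toList.map fun a =>
      chain m r S Z (Function.update τ X a))).cost + (chain m r S Z τ).cost + 1 := rfl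
    have h₃ := hc τ
    have h₄ := Nat.mul_le_mul_left (Fintype.card A) hQ1
    rw [h₂]
    nlinarith
  have h := cost_sum_le (l := (Finset.univ.filter fun z : Z → A => extend x z X = x).toList.map
    fun z => mul (jointFreq m F Z (extend x w) (extend x z)) (dens m r S Z X (extend x z)))
    (c := 97 * (Fintype.card A * Q)) (List.forall_mem_map.2 fun z _ => by
      have h₁ := cost_jointFreq_le hm hN hT (extend x w) (extend x z)
      have h₂ := hd (extend x z)
      have h₃ : (mul (jointFreq m F Z (extend x w) (extend x z))
        (dens m r S Z X (extend x z))).cost = (jointFreq m F Z (extend x w) (extend x z)).cost +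
          (dens m r S Z X (extend x z)).cost + 1 := rfl
      omega)
  rw [List.length_map, Finset.length_toList] at h
  have hcard : (Finset.univ.filter fun z : Z → A => extend x z X = x).card ≤
      Fintype.card A ^ Z.card := by
    refine (Finset.card_filter_le _ _).trans (le_of_eq ?_)
    rw [Finset.card_univ, Fintype.card_fun, Fintype.card_coe]
  have h₁ := Nat.mul_le_mul_right (97 * (Fintype.card A * Q) + 1) hcard
  have h₂ : 1 ≤ Fintype.card A ^ Z.card := Nat.one_le_pow _ _ hs
  have h₃ : 1 ≤ Fintype.card A * Q := hQ1.trans hsQ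
  have h₄ := Nat.mul_le_mul_left (Fintype.card A ^ Z.card) h₃
  refine h.trans ?_
  rw [pow_succ, mul_assoc]
  nlinarith

end Expr

/-- The learning program: it stores the values of the plug-in functional of the empirical
distribution in the cells `1, 2, …`. -/
noncomputable def learner (m : ℕ) (r : V → ℕ) (S Z F : Finset V) (X : V) (x : A) :
    List (Instr V) :=
  Expr.compileList (List.ofFn fun i =>
    Expr.plug m r S Z F X x ((Fintype.equivFin (F → A)).symm i)) 1

/-- The expression that looks up the value for the query and divides it by the sum of all
values. -/
noncomputable def lookup (x : A) (F : Finset V) : Expr V :=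
  .div
    (.sum ((List.finRange (Fintype.card (F → A))).map fun i : Fin _ =>
      .mul (.agree 0 F (extend x ((Fintype.equivFin (F → A)).symm i))) (.cell (1 + i))))
    (.sum ((List.finRange (Fintype.card (F → A))).map fun i : Fin _ => .cell (1 + i)))

/-- The evaluation program. -/
noncomputable def evaluator (x : A) (F : Finset V) : List (Instr V) :=
  -- The stored values occupy the cells from `1` to `Fintype.card (F → A)`, so temporaries start
  -- just above them; the result is then copied to cell `0`.
  (lookup x F).compile (Fintype.card (F → A) + 1) ++
    [.const 0 0, .add 0 0 (Fintype.card (F → A) + 1)]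

variable {m N : ℕ}

theorem jumpFree_learner (r : V → ℕ) (S Z F : Finset V) (X : V) (x : A) :
    ∀ i ∈ learner m r S Z F X x, JumpFree i :=
  Expr.jumpFree_compileList _ _

theorem length_learner_le (hm : 1 ≤ m) (hN : 1 ≤ N) {S Z F : Finset V} (hT : F.card + Z.card ≤ N)
    (hS : 1 ≤ S.card) (r : V → ℕ) (X : V) (x : A) :
    (learner m r S Z F X x).length ≤ 99 * (Fintype.card A ^ (N + 1) * (S.card * (m * N))) := by
  have : Nonempty A := ⟨x⟩
  refine (Expr.length_compileList_le (c := 99 * (Fintype.card A ^ (Z.card + 1) *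
    (S.card * (m * N)))) ?_ 1).trans ?_
  · intro e he
    obtain ⟨i, rfl⟩ := (List.mem_ofFn' _ _).1 he
    exact Expr.cost_plug_le hm hN hT hS r X x _
  · rw [List.length_ofFn, Fintype.card_fun, Fintype.card_coe, mul_left_comm, ← mul_assoc (_ ^ _),
      ← pow_add]
    exact Nat.mul_le_mul_left _ (Nat.mul_le_mul_right _
      (Nat.pow_le_pow_right Fintype.card_pos (by omega)))

theorem run_learner (r : V → ℕ) (S Z F : Finset V) (X : V) (x : A) (s : Fin m → V → A)
    (i : Fin (Fintype.card (F → A))) :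
    (run (sampleInput s) (learner m r S Z F X x) (fun _ => 0) (1 + i) : ℝ) =
      plugIn r S Z F X x (empirical s) ((Fintype.equivFin (F → A)).symm i) := by
  have h := (Expr.run_compileList (sampleInput s) (List.ofFn fun i =>
    Expr.plug m r S Z F X x ((Fintype.equivFin (F → A)).symm i)) (fun e he => by
      obtain ⟨i, rfl⟩ := (List.mem_ofFn' _ _).1 he
      exact Expr.cellsBelow_plug _ _ _ _ _ _ _ _) 1 (fun _ => 0)).1 i
        (by rw [List.length_ofFn]; exact i.2)
  rw [learner, h, List.getElem_ofFn, Expr.eval_plug]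

theorem jumpFree_evaluator (x : A) (F : Finset V) : ∀ i ∈ evaluator x F, JumpFree i := by
  intro i hi
  rcases List.mem_append.1 hi with hi | hi
  · exact Expr.jumpFree_compile _ _ i hi
  · simp only [List.mem_cons, List.not_mem_nil, or_false] at hi
    rcases hi with rfl | rfl <;> trivial

theorem length_evaluator_le (x : A) {F : Finset V} (hF : F.card + 1 ≤ N) :
    (evaluator x F).length ≤ 25 * (Fintype.card A ^ F.card * N) := by
  have : Nonempty A := ⟨x⟩
  have h₁ := Expr.cost_sum_le (l := (List.finRange (Fintype.card (F → A))).map fun i : Fin _ =>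
    Expr.mul (.agree 0 F (extend x ((Fintype.equivFin (F → A)).symm i))) (.cell (1 + i)))
    (c := 12 * F.card + 4) (List.forall_mem_map.2 fun i _ => by
      have h₂ := Expr.cost_agree_le 0 F (extend x ((Fintype.equivFin (F → A)).symm i))
      have h₃ : (Expr.mul (.agree 0 F (extend x ((Fintype.equivFin (F → A)).symm i)))
        (.cell (1 + i))).cost =
        (Expr.agree 0 F (extend x ((Fintype.equivFin (F → A)).symm i))).cost + 2 + 1 := rfl
      omega)
  have h₂ := Expr.cost_sum_le (V := V) (c := 2)
    (l := (List.finRange (Fintype.card (F → A))).map fun i : Fin _ => Expr.cell (1 + i))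
    (List.forall_mem_map.2 fun i _ => le_rfl)
  have h₃ : (evaluator x F).length = (lookup x F).cost + 2 := by
    simp [evaluator, Expr.length_compile]
  have h₄ : (lookup x F).cost = (Expr.sum ((List.finRange (Fintype.card (F → A))).map fun i : Fin _ =>
    Expr.mul (.agree 0 F (extend x ((Fintype.equivFin (F → A)).symm i))) (.cell (1 + i)))).cost +
    (Expr.sum (V := V)
      ((List.finRange (Fintype.card (F → A))).map fun i : Fin _ => Expr.cell (1 + i))).cost + 1 := rfl
  rw [h₃, h₄]
  rw [List.length_map, List.length_finRange] at h₁ h₂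
  have hL : Fintype.card (F → A) = Fintype.card A ^ F.card := by
    rw [Fintype.card_fun, Fintype.card_coe]
  rw [← hL]
  have h₅ : 1 ≤ Fintype.card (F → A) := Fintype.card_pos
  have h₆ := Nat.mul_le_mul_left (Fintype.card (F → A)) hF
  nlinarith

/-- The indicators of agreement with the query select one stored value without indirect addressing.
Normalization takes place here, at query time. -/
theorem isEvaluator_evaluator (x : A) (F : Finset V) (mem : ℕ → ℚ) (g : (F → A) → ℝ)
    (hmem : ∀ i : Fin (Fintype.card (F → A)),
      (mem (1 + i) : ℝ) = g ((Fintype.equivFin (F → A)).symm i))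
    {T : ℝ} (hT : ((evaluator x F).length : ℝ) ≤ T) :
    IsEvaluator (evaluator x F) mem T fun w => g w / ∑ w', g w' := by
  intro w
  refine ⟨_, haltsWithin_of_jumpFree _ _ (jumpFree_evaluator x F) mem hT, ?_⟩
  have hb : (lookup x F).CellsBelow (Fintype.card (F → A) + 1) := by
    refine ⟨Expr.cellsBelow_sum (List.forall_mem_map.2 fun i _ =>
      ⟨Expr.cellsBelow_agree _ _ _ _, ?_⟩), Expr.cellsBelow_sum (List.forall_mem_map.2 fun i _ => ?_)⟩
    all_goals
      have := i.2
      change 1 + (i : ℕ) < _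
      omega
  have h := (Expr.run_compile (queryInput w) _ _ mem hb).1
  have hr : run (queryInput w) (evaluator x F) mem 0 =
      (lookup x F).eval (queryInput w) mem := by
    rw [← h, evaluator, run_append]
    simp [run, effect, exec]
  rw [hr]
  simp only [lookup, Expr.eval, Expr.eval_sum, List.map_map, Function.comp_def, Expr.eval_agree,
    ← Fin.sum_univ_def]
  push_cast
  simp only [hmem]
  rw [Equiv.sum_comp (Fintype.equivFin (F → A)).symm g]
  congr 1
  have hq : ∀ w' : F → A, (∀ v ∈ F, queryInput w 0 v = code (extend x w' v)) ↔ w = w' := by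
    intro w'
    have : ∀ v (hv : v ∈ F), queryInput w 0 v = code (extend x w' v) ↔
        extend x w v = extend x w' v := fun v hv => by
      rw [queryInput, dif_pos hv, code_injective.eq_iff, extend_mem x w hv]
    rw [forall₂_congr this, forall_eq_extend_iff]
    constructor
    · rintro rfl
      funext v
      rw [extend_mem x w v.2]
    · rintro rfl
      funext v
      rw [extend_mem x w v.2]
  simp only [hq]
  rw [Finset.sum_eq_single (Fintype.equivFin (F → A) w)]
  · simp
  · intro i _ hi
    rw [if_neg, Rat.cast_zero, zero_mul]
    rintro rfl
    exact hi (Equiv.apply_symm_apply _ _).symm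
  · simp

end RAM

/-! ### Numerical estimates for the sample size and the running time -/

section Numeric

theorem le_pow_pred {s N : ℕ} (hs : 2 ≤ s) (hN : 1 ≤ N) : N ≤ s ^ (N - 1) := by
  have h : N - 1 < 2 ^ (N - 1) := Nat.lt_two_pow_self
  exact (by omega : N ≤ 2 ^ (N - 1)).trans (Nat.pow_le_pow_left hs _)

theorem mul_pow_succ_le {s N K : ℕ} (hs : 2 ≤ s) (hN : 1 ≤ N) (hK : K ≤ N) :
    K * s ^ (N + 1) ≤ s ^ (2 * N ^ 2) := by
  calc K * s ^ (N + 1) ≤ s ^ (N - 1) * s ^ (N + 1) :=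
        Nat.mul_le_mul_right _ (hK.trans (le_pow_pred hs hN))
    _ = s ^ (N - 1 + (N + 1)) := (pow_add _ _ _).symm
    _ ≤ s ^ (2 * N ^ 2) := Nat.pow_le_pow_right (by omega) (by
        have : N * 1 ≤ N * N := Nat.mul_le_mul_left N hN
        rw [pow_two]
        omega)

/-- In the sample size, `N ^ 2` comes from `η ^ 2`, `s ^ (2 * f)` from the precision per cell and `1
+ N * s` from the union bound. With `n = N - 1` and `N ≤ s ^ n` the exponent is `5 * n + 1`, at most
`2 * (n + 1) ^ 2`. -/
theorem sq_mul_pow_mul_le {s N f : ℕ} (hs : 2 ≤ s) (hN : f + 1 ≤ N) :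
    N ^ 2 * s ^ (2 * f) * (1 + N * s) ≤ 2 * s ^ (2 * N ^ 2) := by
  have hN1 : 1 ≤ N := by omega
  obtain ⟨n, rfl⟩ : ∃ n, N = n + 1 := ⟨N - 1, by omega⟩
  have h := le_pow_pred hs hN1
  rw [Nat.add_sub_cancel] at h
  have h1 : 1 + (n + 1) * s ≤ 2 * (s ^ n * s) := by
    have h2 := Nat.mul_le_mul_right s h
    have h3 : 1 * 1 ≤ (n + 1) * s := Nat.mul_le_mul (by omega) (by omega)
    omega
  calc (n + 1) ^ 2 * s ^ (2 * f) * (1 + (n + 1) * s)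
      ≤ (s ^ n) ^ 2 * s ^ (2 * n) * (2 * (s ^ n * s)) :=
        Nat.mul_le_mul (Nat.mul_le_mul (Nat.pow_le_pow_left h 2)
          (Nat.pow_le_pow_right (by omega) (by omega))) h1
    _ = 2 * s ^ (5 * n + 1) := by ring
    _ ≤ 2 * s ^ (2 * (n + 1) ^ 2) := by
        refine Nat.mul_le_mul_left 2 (Nat.pow_le_pow_right (by omega) ?_)
        rcases n with _ | n
        · omega
        · nlinarith

/-- The failure probability in the union bound. -/
theorem card_mul_exp_le {m N f k s c : ℕ} {α ε δ : ℝ} (hs : 2 ≤ s) (hN : f + 1 ≤ N) (hk : 1 ≤ k)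
    (hα : 0 < α) (hα' : α < 1) (hε : 0 < ε) (hδ : 0 < δ) (hδ' : δ < 1) (hc : c ≤ s ^ N)
    (hm : 2 ^ 15 * ((s : ℝ) ^ (2 * N ^ 2) / (α ^ k * ε ^ 2)) * (1 + Real.log (1 / δ)) ≤ m) :
    c * (2 * Real.exp (-(m * α * (ε / (64 * N) / (s : ℝ) ^ f) ^ 2 / 4))) ≤ δ := by
  have hl : 0 ≤ Real.log (1 / δ) := Real.log_nonneg (by rw [le_div_iff₀ hδ]; linarith)
  set l := Real.log (1 / δ) with hldef
  have hs0 : (0 : ℝ) < s := by positivity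
  have hN0 : (0 : ℝ) < N := by
    have : 0 < N := by omega
    positivity
  have hnum : (N : ℝ) ^ 2 * (s : ℝ) ^ (2 * f) * (1 + N * s) ≤ 2 * (s : ℝ) ^ (2 * N ^ 2) := by
    exact_mod_cast sq_mul_pow_mul_le hs hN
  -- One power of `α` suffices: every event is measured against a probability larger than `α`.
  have hαk : α ^ k ≤ α := pow_le_of_le_one hα.le hα'.le (by omega)
  have h1 : 2 ^ 15 * (s : ℝ) ^ (2 * N ^ 2) * (1 + l) ≤ m * (α * ε ^ 2) := by
    have h2 : 2 ^ 15 * ((s : ℝ) ^ (2 * N ^ 2) / (α * ε ^ 2)) * (1 + l) ≤ m := by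
      refine le_trans ?_ hm
      gcongr
    rw [mul_div_assoc', div_mul_eq_mul_div, div_le_iff₀ (by positivity)] at h2
    exact h2
  -- The three terms pay for the factor `2 ≤ exp 1`, for the `c ≤ s ^ N ≤ exp (N * s)` events, and
  -- for `δ`. Here `2 ^ 14 = 64 ^ 2 * 4`, and the last factor of `2 ^ 15` is the `2` in `hnum`.
  have h3 : 1 + N * s + l ≤ m * α * (ε / (64 * N) / (s : ℝ) ^ f) ^ 2 / 4 := by
    have e : m * α * (ε / (64 * N) / (s : ℝ) ^ f) ^ 2 / 4 =
        m * (α * ε ^ 2) / (2 ^ 14 * ((N : ℝ) ^ 2 * (s : ℝ) ^ (2 * f))) := by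
      rw [mul_comm 2 f, pow_mul]
      field_simp
      ring
    rw [e, le_div_iff₀ (by positivity)]
    have h4 : 1 + N * s + l ≤ (1 + N * s) * (1 + l) := by
      nlinarith [mul_nonneg (mul_pos hN0 hs0).le hl]
    have h5 : (1 + N * s + l) * (2 ^ 14 * ((N : ℝ) ^ 2 * (s : ℝ) ^ (2 * f))) ≤
        ((1 + N * s) * (1 + l)) * (2 ^ 14 * ((N : ℝ) ^ 2 * (s : ℝ) ^ (2 * f))) :=
      mul_le_mul_of_nonneg_right h4 (by positivity)
    have h6 := mul_le_mul_of_nonneg_right hnum (by positivity : 0 ≤ 2 ^ 14 * (1 + l))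
    linarith
  have h7 : Real.exp (-(m * α * (ε / (64 * N) / (s : ℝ) ^ f) ^ 2 / 4)) ≤
      Real.exp (-1) * Real.exp (-(N * s)) * δ := by
    refine (Real.exp_le_exp.2 (neg_le_neg h3)).trans (le_of_eq ?_)
    rw [neg_add, neg_add, Real.exp_add, Real.exp_add, hldef, Real.log_div one_ne_zero hδ.ne',
      Real.log_one, zero_sub, neg_neg, Real.exp_log hδ]
  have h8 : (c : ℝ) ≤ Real.exp (N * s) := by
    calc (c : ℝ) ≤ (s : ℝ) ^ N := by exact_mod_cast hc
      _ ≤ Real.exp s ^ N := by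
        gcongr
        linarith [Real.add_one_le_exp (s : ℝ)]
      _ = _ := by rw [← Real.exp_nat_mul]
  have h9 : (2 : ℝ) ≤ Real.exp 1 := by linarith [Real.add_one_le_exp (1 : ℝ)]
  calc c * (2 * Real.exp (-(m * α * (ε / (64 * N) / (s : ℝ) ^ f) ^ 2 / 4)))
      ≤ Real.exp (N * s) * (Real.exp 1 * (Real.exp (-1) * Real.exp (-(N * s)) * δ)) := by gcongr
    _ = (Real.exp (N * s) * Real.exp (-(N * s))) * (Real.exp 1 * Real.exp (-1)) * δ := by ring
    _ = δ := by rw [← Real.exp_add, ← Real.exp_add]; simp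

end Numeric

/-! ### Sizes of c-components and their parent sets; marginals -/

namespace ADMG

variable {V : Type*} [Fintype V] (G : ADMG V)

theorem card_cComponent_pos (X : V) : 1 ≤ (G.cComponent X).card :=
  Finset.card_pos.2 ⟨X, G.mem_cComponent_self X⟩

theorem card_cComponent_le (X : V) : (G.cComponent X).card ≤ G.maxCComponent :=
  Finset.le_sup (f := fun v => (G.cComponent v).card) (Finset.mem_univ X)

theorem card_paPlus_le [DecidableEq V] (X : V) :
    (G.paPlus (G.cComponent X)).card ≤ G.maxCComponent * (G.inDegree + 1) := by
  have h : ((G.cComponent X).biUnion G.parents).card ≤ (G.cComponent X).card * G.inDegree :=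
    Finset.card_biUnion_le_card_mul _ _ _ fun v _ =>
      Finset.le_sup (f := fun v => (G.parents v).card) (Finset.mem_univ v)
  have h₁ := Nat.mul_le_mul_right (G.inDegree + 1) (G.card_cComponent_le X)
  have h₂ := Finset.card_union_le (G.cComponent X) ((G.cComponent X).biUnion G.parents)
  rw [mul_add, mul_one] at h₁
  unfold paPlus
  omega

end ADMG

section Marginal

variable {V : Type*} [Fintype V] [DecidableEq V] {A : Type*} [Fintype A] [DecidableEq A]

theorem marginal_eq_cyl (p : (V → A) → ℝ) (S : Finset V) (x : A) (z : S → A) :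
    marginal S p z = cyl p S (extend x z) := by
  classical
  simp only [marginal, cyl, mass, forall_eq_extend_iff, Finset.sum_filter]

theorem isDistribution_marginal {p : (V → A) → ℝ} (hp : IsDistribution p) (S : Finset V) :
    IsDistribution (marginal S p) :=
  ⟨fun _ => Finset.sum_nonneg fun σ _ => hp.1 σ, by
    rw [← hp.2]
    exact Finset.sum_fiberwise _ _ _⟩

end Marginal

/-! ### Accuracy of the estimator and the main theorem -/

namespace CausalBayesNet

variable {V : Type u} [Fintype V] [DecidableEq V] {G : ADMG V} {A : Type v} [Fintype A]
  [DecidableEq A] (M : CausalBayesNet.{u, v, w} G A)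

/-- With high probability, the plug-in functional of the empirical distribution, normalized, is
close to the interventional distribution. -/
theorem one_sub_le_iidProb_plugIn {r : V → ℕ} (hr : Function.Injective r)
    (hdir : ∀ a b, G.directed a b → r a < r b) {X : V} (hX : G.Identifiable X) (F : Finset V)
    (x : A) {α ε δ : ℝ} (hα : 0 < α) (hα' : α < 1) (hε : 0 < ε) (hε' : ε < 1) (hδ : 0 < δ)
    (hδ' : δ < 1) {N k m : ℕ} (hs : 2 ≤ Fintype.card A) (hk : 1 ≤ k) (hF : F.card + 1 ≤ N)
    (hS : (G.cComponent X).card ≤ N) (hZ : F.card + (G.paPlus (G.cComponent X)).card ≤ N)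
    (hm : 2 ^ 15 * ((Fintype.card A : ℝ) ^ (2 * N ^ 2) / (α ^ k * ε ^ 2)) *
      (1 + Real.log (1 / δ)) ≤ m) (hm0 : 0 < m) (hM : M.StronglyPositive X α) :
    1 - δ ≤ iidProb M.obs m fun s =>
      IsDistribution (fun w =>
        plugIn r (G.cComponent X) (G.paPlus (G.cComponent X)) F X x (empirical s) w /
          ∑ w', plugIn r (G.cComponent X) (G.paPlus (G.cComponent X)) F X x (empirical s) w') ∧
      tvDist (marginal F (M.interv X x)) (fun w =>
        plugIn r (G.cComponent X) (G.paPlus (G.cComponent X)) F X x (empirical s) w /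
          ∑ w', plugIn r (G.cComponent X) (G.paPlus (G.cComponent X)) F X x (empirical s) w') ≤
        ε := by
  have : Nonempty A := ⟨x⟩
  set S := G.cComponent X with hSdef
  set Z := G.paPlus S with hZdef
  have hobs := M.isDistribution_obs
  have hN0 : (1 : ℝ) ≤ N := by
    have : 1 ≤ N := by omega
    exact_mod_cast this
  have hs1 : (1 : ℝ) ≤ (Fintype.card A : ℝ) ^ F.card :=
    one_le_pow₀ (by exact_mod_cast (by omega : 1 ≤ Fintype.card A))
  have hpos : ∀ τ, α < cyl M.obs Z τ := fun τ => by
    rw [cyl_extend M.obs Z x, ← marginal_eq_cyl]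
    exact hM _
  have hpos' : ∀ Z' ⊆ Z, ∀ τ, 0 < cyl M.obs Z' τ := fun Z' h τ =>
    (hα.trans (hpos τ)).trans_le (mass_mono hobs.1 fun σ hσ v hv => hσ v (h hv))
  -- Chosen so that `8 * S.card * η ≤ ε / 8`, hence `γ = ε / 4` works and `η * (1 + γ) + γ ≤ ε / 2`.
  set η := ε / (64 * N) with hη
  have hη0 : 0 ≤ η := by positivity
  have hηle : η ≤ ε / 64 := by
    rw [hη]
    gcongr
    linarith
  have hid := M.plugIn_obs hr hdir hX (fun τ => hα.trans (hpos τ)) F x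
  have hdist : IsDistribution (marginal F (M.interv X x)) :=
    isDistribution_marginal ⟨M.interv_nonneg X x, M.sum_interv X x⟩ F
  have hγ : Real.exp (8 * S.card * η) ≤ 1 + ε / 4 := by
    have h1 : 8 * S.card * η ≤ ε / 8 := by
      have : (S.card : ℝ) ≤ N := by exact_mod_cast hS
      rw [hη, mul_div_assoc', div_le_div_iff₀ (by positivity) (by norm_num)]
      nlinarith [mul_le_mul_of_nonneg_right this hε.le]
    have h2 := (abs_le.1 (Real.abs_exp_sub_one_sub_id_le (x := ε / 8)
      (by rw [abs_of_nonneg (by positivity)]; linarith))).2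
    have h3 := Real.exp_le_exp.2 h1
    nlinarith
  have hconc := one_sub_le_iidProb_forall hobs hm0 (ι := (F → A) × (Z → A))
    (fun i σ => (∀ v ∈ F, σ v = extend x i.1 v) ∧ ∀ v ∈ Z, σ v = extend x i.2 v)
    (fun i => cyl M.obs Z (extend x i.2))
    (fun i => mass_mono hobs.1 fun σ h => h.2) (β := α)
    (η := η / (Fintype.card A : ℝ) ^ F.card) (fun i => (hpos _).le) (by positivity)
    ((div_le_self hη0 hs1).trans (by linarith))
  have hcard := card_mul_exp_le (c := Fintype.card ((F → A) × (Z → A))) hs hF hk hα hα' hε hδ hδ'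
    (by
      rw [Fintype.card_prod, Fintype.card_fun, Fintype.card_fun, Fintype.card_coe,
        Fintype.card_coe, ← pow_add]
      exact Nat.pow_le_pow_right (by omega) hZ) hm
  refine (sub_le_sub_left hcard 1).trans (hconc.trans (iidProb_mono hobs.1 fun s h => ?_))
  have hemp : ∀ σ, 0 ≤ empirical s σ := fun σ =>
    div_nonneg (Finset.sum_nonneg fun j _ => by split_ifs <;> norm_num) (Nat.cast_nonneg m)
  have herr := sum_abs_plugIn_sub_le (q := empirical s) (F := F) (r := r) (S := S) (X := X)
    (x := x) hη0 (by linarith) hpos' hobs.1 (fun w z => h (w, z)) hγ (by rw [hid]; exact hdist.2)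
  rw [hid] at herr
  have hfin := isDistribution_div_sum (e := ε / 2) hdist (plugIn_nonneg (r := r) (S := S) (Z := Z)
    (F := F) (X := X) (x := x) hemp) (herr.trans (by nlinarith)) (by linarith)
  exact ⟨hfin.1, hfin.2.trans (by linarith)⟩

end CausalBayesNet

theorem mainTheorem3 :
    ∃ (C : ℝ) (c : ℕ), 0 < C ∧
      ∀ (V : Type u) [Fintype V] [DecidableEq V] (A : Type v) [Fintype A] [DecidableEq A]
        (G : ADMG V) (X : V) (_ : G.Identifiable X) (F : Finset V) (x : A)
        (α ε δ : ℝ) (_ : 0 < α) (_ : α < 1) (_ : 0 < ε) (_ : ε < 1) (_ : 0 < δ) (_ : δ < 1)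
        (k d N : ℕ) (_ : k = G.maxCComponent) (_ : d = G.inDegree)
        (_ : N = F.card + k * (d + 1))
        (B : ℝ) (_ : B = (Fintype.card A : ℝ) ^ (2 * N ^ 2) / (α ^ k * ε ^ 2)),
        ∃ (m : ℕ) (T : ℝ) (learn eval : List (Instr V)),
          (m : ℝ) ≤ C * (B * (1 + Real.log B) ^ c * (1 + Real.log (1 / δ))) ∧
          T = C * (m * N * (Fintype.card A : ℝ) ^ (2 * N ^ 2)) ∧
          (learn.length : ℝ) ≤ T ∧ (eval.length : ℝ) ≤ T ∧
          ∃ out : (Fin m → V → A) → (ℕ → ℚ),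
            (∀ s : Fin m → V → A,
              RAM.HaltsWithin learn (RAM.sampleInput s) (fun _ => 0) T (out s)) ∧
            ∀ M : CausalBayesNet.{u, v, w} G A, M.StronglyPositive X α →
              1 - δ ≤ iidProb M.obs m fun s =>
                ∃ p : (F → A) → ℝ,
                  IsDistribution p ∧
                  tvDist (marginal F (M.interv X x)) p ≤ ε ∧
                  RAM.IsEvaluator eval (out s) T p := by
  -- No logarithm of `B` is needed, so `c = 0`. Doubling `2 ^ 15` absorbs the rounding up of `m`.
  refine ⟨2 ^ 16, 0, by norm_num, ?_⟩
  intro V _ _ A _ _ G X hX F x α ε δ hα hα' hε hε' hδ hδ' k d N hk hd hN B hB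
  have : Nonempty A := ⟨x⟩
  have hS1 := G.card_cComponent_pos X
  have hSk : (G.cComponent X).card ≤ k := hk ▸ G.card_cComponent_le X
  have hZk : (G.paPlus (G.cComponent X)).card ≤ k * (d + 1) := by
    rw [hk, hd]
    exact G.card_paPlus_le X
  have hkk : k ≤ k * (d + 1) := Nat.le_mul_of_pos_right _ (Nat.succ_pos d)
  have hl : 0 ≤ Real.log (1 / δ) := Real.log_nonneg (by rw [le_div_iff₀ hδ]; linarith)
  have hcard1 : 1 ≤ Fintype.card A := Fintype.card_pos
  have hpow1 : (1 : ℝ) ≤ (Fintype.card A : ℝ) ^ (2 * N ^ 2) :=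
    one_le_pow₀ (by exact_mod_cast hcard1)
  have hN1 : (1 : ℝ) ≤ N := by
    have : 1 ≤ N := by omega
    exact_mod_cast this
  have hB1 : 1 ≤ B := by
    rw [hB, le_div_iff₀ (by positivity), one_mul]
    refine le_trans ?_ hpow1
    exact mul_le_one₀ (pow_le_one₀ hα.le hα'.le) (by positivity) (pow_le_one₀ hε.le hε'.le)
  have hBl : 1 ≤ B * (1 + Real.log (1 / δ)) := by nlinarith
  -- With one symbol, powers of `|A|` cannot absorb `N`, but then there is only one distribution and
  -- the constant evaluator `1` is exact.
  rcases hcard1.eq_or_lt with hA | hA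
  · have hsub : Subsingleton A := Fintype.card_le_one_iff_subsingleton.1 hA.ge
    have huniq : ∀ p : (F → A) → ℝ, IsDistribution p → p = fun _ => 1 := fun p hp => by
      funext w
      rw [← hp.2, Fintype.sum_subsingleton _ w]
    have h1 : IsDistribution fun _ : F → A => (1 : ℝ) :=
      ⟨fun _ => zero_le_one, by rw [Fintype.sum_subsingleton _ fun _ => x]⟩
    have hT : (1 : ℝ) ≤ 2 ^ 16 * ((1 : ℕ) * N * (Fintype.card A : ℝ) ^ (2 * N ^ 2)) := by
      rw [Nat.cast_one, one_mul]
      nlinarith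
    refine ⟨1, _, [], [.const 0 1], ?_, rfl, ?_, ?_, fun _ _ => 0, ?_, fun M _ => ?_⟩
    · rw [pow_zero, mul_one, Nat.cast_one]
      linarith
    · rw [List.length_nil, Nat.cast_zero]
      linarith
    · rw [List.length_singleton]
      simpa using hT
    · intro s
      refine RAM.haltsWithin_of_jumpFree _ _ (by simp) _ ?_
      rw [List.length_nil, Nat.cast_zero]
      linarith
    · rw [iidProb_of_forall M.isDistribution_obs]
      · linarith
      · intro s
        refine ⟨fun _ => 1, h1, ?_, fun w => ⟨_, RAM.haltsWithin_of_jumpFree _ _ ?_ _ ?_, ?_⟩⟩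
        · rw [huniq _ (isDistribution_marginal ⟨M.interv_nonneg X x, M.sum_interv X x⟩ F)]
          simpa [tvDist] using hε.le
        · simp [RAM.JumpFree]
        · rw [List.length_singleton]
          simpa using hT
        · simp [RAM.run, RAM.effect, RAM.exec]
  · obtain ⟨r, hr, hdir⟩ := G.exists_rank
    have hs : 2 ≤ Fintype.card A := hA
    set m := ⌈2 ^ 15 * B * (1 + Real.log (1 / δ))⌉₊ with hm
    have hmge : 2 ^ 15 * B * (1 + Real.log (1 / δ)) ≤ m := Nat.le_ceil _
    have hm1 : (1 : ℝ) ≤ m := by linarith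
    have hm0 : 1 ≤ m := by exact_mod_cast hm1
    have hmle : (m : ℝ) ≤ 2 ^ 16 * (B * (1 + Real.log (1 / δ))) := by
      have := Nat.ceil_lt_add_one (a := 2 ^ 15 * B * (1 + Real.log (1 / δ))) (by linarith)
      rw [← hm] at this
      linarith
    have hS : (G.cComponent X).card ≤ N := by omega
    have hZ : F.card + (G.paPlus (G.cComponent X)).card ≤ N := by omega
    have hF : F.card + 1 ≤ N := by omega
    set learn := RAM.learner m r (G.cComponent X) (G.paPlus (G.cComponent X)) F X x with hlearn
    have hlearnT : (learn.length : ℝ) ≤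
        2 ^ 16 * (m * N * (Fintype.card A : ℝ) ^ (2 * N ^ 2)) := by
      have h1 := RAM.length_learner_le (m := m) (N := N) hm0 (by omega) hZ hS1 r X x
      have h2 := Nat.mul_le_mul_right (m * N) (mul_pow_succ_le hs (by omega : 1 ≤ N) hS)
      have h3 : learn.length ≤ 2 ^ 16 * (m * N * Fintype.card A ^ (2 * N ^ 2)) := by
        refine h1.trans ?_
        nlinarith
      exact_mod_cast h3
    have hevalT : ((RAM.evaluator x F).length : ℝ) ≤
        2 ^ 16 * (m * N * (Fintype.card A : ℝ) ^ (2 * N ^ 2)) := by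
      have h1 := RAM.length_evaluator_le x hF
      have h2 : Fintype.card A ^ F.card ≤ Fintype.card A ^ (2 * N ^ 2) :=
        Nat.pow_le_pow_right (by omega) (by nlinarith)
      have h4 : Fintype.card A ^ F.card * N ≤ m * (Fintype.card A ^ (2 * N ^ 2) * N) :=
        (Nat.mul_le_mul_right N h2).trans (Nat.le_mul_of_pos_left _ hm0)
      have h3 : (RAM.evaluator x F).length ≤ 2 ^ 16 * (m * N * Fintype.card A ^ (2 * N ^ 2)) := by
        refine h1.trans ?_
        nlinarith
      exact_mod_cast h3
    refine ⟨m, _, learn, RAM.evaluator x F, ?_, rfl, hlearnT, hevalT,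
      fun s => RAM.run (RAM.sampleInput s) learn fun _ => 0, fun s =>
        RAM.haltsWithin_of_jumpFree _ _ (RAM.jumpFree_learner r _ _ F X x) _ hlearnT,
      fun M hM => ?_⟩
    · rw [pow_zero, mul_one]
      exact hmle
    · refine (M.one_sub_le_iidProb_plugIn hr hdir hX F x hα hα' hε hε' hδ hδ' hs
        (hS1.trans hSk) hF hS hZ (hB ▸ hmge) hm0 hM).trans
        (iidProb_mono M.isDistribution_obs.1 fun s h => ?_)
      exact ⟨_, h.1, h.2, RAM.isEvaluator_evaluator x F _ _
        (fun i => RAM.run_learner r _ _ F X x s i) hevalT⟩
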